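/- Let $\hbar,m>0$ and let $V:\mathbb R\to\mathbb R$ be continuously differentiable with $V'$ of at most polynomial growth; put $H(p,x)=\frac{p^2}{2m}+V(x)$. For a wave function $\psi$ in the Schwartz space $\mathcal S(\mathbb R)$ let $$P(p,x)=\frac1{2\pi\hbar}\int\psi^*\!\left(x-\tfrac y2\right)\psi\!\left(x+\tfrac y2\right)e^{-ipy/\hbar}\,dy$$ be its Wigner function, with Wigner flow $\mathcal J_p=-P\odot\partial_xH$, $\mathcal J_x=P\odot\partial_pH\;(=\frac pmP)$, where $\odot=\operatorname{sinc}\big(\frac\hbar2(\overleftarrow{\partial_x}\overrightarrow{\partial_p}-\overleftarrow{\partial_p}\overrightarrow{\partial_x})\big)$ is understood by Fourier transformation of the left factor: for $f(p,x)=e^{i(\xi p+\eta x)}$ it is $f\odot b=f\cdot\frac12\int_{-1}^1b\big(p-\frac{s\hbar\eta}2,x+\frac{s\hbar\xi}2\big)ds$. For $\sigma_p,\sigma_x>0$ let $K$ denote convolution on phase space with the Gaussian kernel $\frac1{2\pi\sigma_p\sigma_x}e^{-\delta p^2/2\sigma_p^2-\delta x^2/2\sigma_x^2}$. Let $Q=KP$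 be the generalized Husimi function and $K\mathcal J_p$, $K\mathcal J_x$ the Husimi flow in the default gauge. The regularized Bohmian momentum and the regularized Bohmian gauge potential are $$\tilde p_B(x)=\frac{\int K(pP)(p,x)\,dp}{\int Q(p,x)\,dp},\qquad A(p,x)=\frac1m\left(\tilde p_B(x)\int_{-\infty}^pQ(q,x)\,dq-\int_{-\infty}^pK(pP)(q,x)\,dq\right),$$ and the Husimi flow in this gauge is $J_p=K\mathcal J_p-\partial_xA$, $J_x=K\mathcal J_x+\partial_pA$. (i) This flow represents the evolution of the fluid: if $t\mapsto\psi(\cdot,t)$ is a continuous $\mathcal S(\mathbb R)$-valued curve on an open set of times which satisfies $i\hbar\,\partial_t\psi=-\frac{\hbar^2}{2m}\partial_x^2\psi+V\psi$ pointwise, then for all $\sigma_p,\sigma_x>0$ the derivatives in the following equation exist, and $\partial_tQ=-\partial_pJ_p-\partial_xJ_x$. (ii) Let $\psi\in\mathcal S(\mathbb R)$. In the singular limit $\sigma_x\to0^+$, $\sigma_p\to+\infty$ (taken jointly), for every $p$ and every $x$ with $\psi(x)\neq0$, $$\sqrt{2\pi}\,\sigma_p\,Q(p,x)\to|\psi(x)|^2,\qquad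 \tilde p_B(x)\to p_B(x),$$ and the flow becomes $J_x=\frac{p_B(x)}mQ$, $J_p=-\partial_x\big(V(x)+V_B(x)\big)Q$, in the sense that $$\frac{J_x(p,x)}{Q(p,x)}\to\frac{p_B(x)}m,\qquad\frac{J_p(p,x)}{Q(p,x)}\to-\frac{\partial}{\partial x}\big(V(x)+V_B(x)\big),$$ where $p_B(x)=\operatorname{Re}\frac{-i\hbar\,\psi'(x)}{\psi(x)}$ is the Bohmian momentum and $V_B(x)=-\frac{\hbar^2}{2m|\psi(x)|}\frac{\partial^2}{\partial x^2}|\psi(x)|$ is the quantum potential. -/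

import Mathlib

open Filter Topology

noncomputable section

namespace HusimiFluid

/-- The Wigner function of the pure state `ψ`,
`P(p,x) = (2πℏ)⁻¹ ∫ ψ*(x - y/2) ψ(x + y/2) exp(-i p y / ℏ) dy`.
The integral is always a real number (substitute `y ↦ -y`), so `re` only changes its type. -/
def wigner (hbar : ℝ) (ψ : ℝ → ℂ) (p x : ℝ) : ℝ :=
  (1 / (2 * Real.pi * hbar)) *
    (∫ y : ℝ, starRingEnd ℂ (ψ (x - y / 2)) * ψ (x + y / 2) *
      Complex.exp (-Complex.I * ((p * y / hbar : ℝ) : ℂ))).re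

/-- The Weyl symbol `H(p,x) = p² / (2m) + V(x)` of the Hamiltonian. -/
def weylHamiltonian (m : ℝ) (V : ℝ → ℝ) (p x : ℝ) : ℝ :=
  p ^ 2 / (2 * m) + V x

/-- The Fourier transform of a phase-space function,
`∫∫ f(p,x) exp(-i (ξ p + η x)) dp dx`. -/
def phaseFourier (f : ℝ → ℝ → ℝ) (ξ η : ℝ) : ℂ :=
  ∫ x : ℝ, ∫ p : ℝ,
    (f p x : ℂ) * Complex.exp (-Complex.I * ((ξ * p + η * x : ℝ) : ℂ))

/-- The binary operation `f sinc((ℏ/2)(←∂ₓ →∂ₚ - ←∂ₚ →∂ₓ)) b`.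
On a plane wave `exp(i (ξ p + η x))` the derivatives acting to the left become `←∂ₚ = iξ` and
`←∂ₓ = iη`; then, because `sinc z = (1/2) ∫_{-1}^{1} exp(i s z) ds`, the operator acting on `b` is
the average of the translations `exp(-(s ℏ / 2)(η ∂ₚ - ξ ∂ₓ))`, that is
`(1/2) ∫_{-1}^{1} b(p - s ℏ η / 2, x + s ℏ ξ / 2) ds`. The operation is extended from plane waves to
all `f` by Fourier inversion. (For `b` polynomial and `f` a Schwartz function this is the finite
sum that the power series of `sinc` gives.) The result is real for real `f` and `b`. -/
def sincProduct (hbar : ℝ) (f b : ℝ → ℝ → ℝ) (p x : ℝ) : ℝ :=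
  (1 / (2 * Real.pi) ^ 2) *
    (∫ ξ : ℝ, ∫ η : ℝ,
      phaseFourier f ξ η * Complex.exp (Complex.I * ((ξ * p + η * x : ℝ) : ℂ)) *
        (((1 / 2) * ∫ s in (-1 : ℝ)..1,
          b (p - s * hbar * η / 2) (x + s * hbar * ξ / 2) : ℝ) : ℂ)).re

/-- Momentum component of the Wigner flow, `-P sinc(…) ∂H/∂x`. -/
def wignerFlowP (hbar m : ℝ) (V : ℝ → ℝ) (ψ : ℝ → ℂ) (p x : ℝ) : ℝ :=
  -sincProduct hbar (wigner hbar ψ)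
    (fun p' x' => deriv (fun z => weylHamiltonian m V p' z) x') p x

/-- Position component of the Wigner flow, `P sinc(…) ∂H/∂p`. -/
def wignerFlowX (hbar m : ℝ) (V : ℝ → ℝ) (ψ : ℝ → ℂ) (p x : ℝ) : ℝ :=
  sincProduct hbar (wigner hbar ψ)
    (fun p' x' => deriv (fun z => weylHamiltonian m V z x') p') p x

/-- The Gaussian kernel with widths `σp`, `σx`. -/
def husimiKernel (σp σx δp δx : ℝ) : ℝ :=
  1 / (2 * Real.pi * σp * σx) *
    Real.exp (-(δp ^ 2 / (2 * σp ^ 2)) - δx ^ 2 / (2 * σx ^ 2))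

/-- Convolution of a phase-space function with the Gaussian kernel. -/
def smooth (σp σx : ℝ) (f : ℝ → ℝ → ℝ) (p x : ℝ) : ℝ :=
  ∫ x' : ℝ, ∫ p' : ℝ, f p' x' * husimiKernel σp σx (p - p') (x - x')

/-- The generalized Husimi function `Q`. -/
def husimi (hbar σp σx : ℝ) (ψ : ℝ → ℂ) : ℝ → ℝ → ℝ :=
  smooth σp σx (wigner hbar ψ)

/-- Momentum component of the Husimi flow in the default gauge. -/
def husimiFlowP (hbar m σp σx : ℝ) (V : ℝ → ℝ) (ψ : ℝ → ℂ) : ℝ → ℝ → ℝ :=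
  smooth σp σx (wignerFlowP hbar m V ψ)

/-- Position component of the Husimi flow in the default gauge. -/
def husimiFlowX (hbar m σp σx : ℝ) (V : ℝ → ℝ) (ψ : ℝ → ℂ) : ℝ → ℝ → ℝ :=
  smooth σp σx (wignerFlowX hbar m V ψ)

/-- The smoothed first-moment density: the Gaussian convolution of `p P(p,x)`. -/
def smoothMomentum (hbar σp σx : ℝ) (ψ : ℝ → ℂ) : ℝ → ℝ → ℝ :=
  smooth σp σx (fun p' x' => p' * wigner hbar ψ p' x')

/-- The regularized Bohmian momentum, a function of the position only. -/
def regBohmianMomentum (hbar σp σx : ℝ) (ψ : ℝ → ℂ) (x : ℝ) : ℝ :=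
  (∫ p : ℝ, smoothMomentum hbar σp σx ψ p x) / ∫ p : ℝ, husimi hbar σp σx ψ p x

/-- The regularized Bohmian gauge potential. -/
def bohmianGauge (hbar m σp σx : ℝ) (ψ : ℝ → ℂ) (p x : ℝ) : ℝ :=
  (1 / m) *
    (regBohmianMomentum hbar σp σx ψ x * (∫ q in Set.Iic p, husimi hbar σp σx ψ q x) -
      ∫ q in Set.Iic p, smoothMomentum hbar σp σx ψ q x)

/-- Momentum component of the Husimi flow in the regularized Bohmian gauge: the default flow
plus `-∂/∂x` of the gauge potential. -/
def bohmianFlowP (hbar m σp σx : ℝ) (V : ℝ → ℝ) (ψ : ℝ → ℂ) (p x : ℝ) : ℝ :=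
  husimiFlowP hbar m σp σx V ψ p x
    + -deriv (fun x' => bohmianGauge hbar m σp σx ψ p x') x

/-- Position component of the Husimi flow in the regularized Bohmian gauge: the default flow
plus `∂/∂p` of the gauge potential. -/
def bohmianFlowX (hbar m σp σx : ℝ) (V : ℝ → ℝ) (ψ : ℝ → ℂ) (p x : ℝ) : ℝ :=
  husimiFlowX hbar m σp σx V ψ p x
    + deriv (fun p' => bohmianGauge hbar m σp σx ψ p' x) p

/-- The Bohmian momentum `Re[(-iℏ ψ'(x)) / ψ(x)]`. -/
def bohmianMomentum (hbar : ℝ) (ψ : ℝ → ℂ) (x : ℝ) : ℝ :=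
  (-Complex.I * (hbar : ℂ) * deriv ψ x / ψ x).re

/-- The quantum potential `-ℏ² / (2 m |ψ|) ∂²|ψ|/∂x²`. -/
def quantumPotential (hbar m : ℝ) (ψ : ℝ → ℂ) (x : ℝ) : ℝ :=
  -(hbar ^ 2 / (2 * m * ‖ψ x‖)) * iteratedDeriv 2 (fun z => ‖ψ z‖) x

/-- The Schrödinger operator, `-ℏ²/(2m) ψ'' + V ψ`. -/
def hamiltonian (hbar m : ℝ) (V : ℝ → ℝ) (ψ : ℝ → ℂ) (x : ℝ) : ℂ :=
  -((hbar ^ 2 / (2 * m) : ℝ) : ℂ) * iteratedDeriv 2 ψ x + (V x : ℂ) * ψ x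

/-- The limit `σp → +∞`, `σx → 0⁺` (jointly, without any relation between the two rates);
the pairs are `(σp, σx)`. -/
def bohmianLimit : Filter (ℝ × ℝ) := atTop ×ˢ 𝓝[>] (0 : ℝ)

end HusimiFluid

end

open HusimiFluid

/-
Every phase-space function in the problem is the real part of the Fourier transform in `y` of an
off-diagonal function `F(x, y)`, such as `ψ*(x - y/2) ψ(x + y/2)` for the Wigner function. The sinc
product with `V'` multiplies this density by the symmetric mean of `V'` over `[x - y/2, x + y/2]`;
times `y` that mean is `V(x + y/2) - V(x - y/2)`, so `-∂ₚ` of the Wigner flow is the potential part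
of the von Neumann equation and the kinetic part is `-∂ₓ(p P)/m`. Smoothing commutes with all of
this, and the gauge potential drops out of the divergence because its mixed partial derivatives
agree.

Gaussian smoothing turns `F` into the average of `F(x - σₓ z₂, (ℏ/σₚ) z₁) exp(-i (p/σₚ) z₁)` over
standard Gaussians `z₁`, `z₂`, up to the factor `1/(√(2π) σₚ)`, so in the singular limit only the
diagonal value `F(x, 0)` survives. In the gauge potential the momentum kernel is a Gaussian cdf,
`1/2 + (p - q)/(√(2π) σₚ) + …`. The terms with `1/2` cancel, since the regularized Bohmian momentum
is the ratio of the marginals, and the next order yields minus the divergence of the momentum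
dispersion, divided by `m`: this is the quantum force `-ρ ∂ₓV_B`.
-/

noncomputable section

namespace HusimiFluid

open MeasureTheory ProbabilityTheory Set SchwartzMap
open scoped Real FourierTransform

/-- The Gaussian weight of width `σ` normalized to be `1` at the origin instead of having total
mass `1`, so that it converges as `σ → ∞`. -/
def gaussWeight (σ u : ℝ) : ℝ := Real.exp (-(u ^ 2 / (2 * σ ^ 2)))

/-- The primitive of `gaussWeight σ` that vanishes at the origin. -/
def gaussPrimitive (σ u : ℝ) : ℝ := ∫ r in (0 : ℝ)..u, gaussWeight σ r

/-- The standard Gaussian measure. -/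
abbrev stdGauss : Measure ℝ := gaussianReal 0 1

/-- The centred Gaussian measure of width (standard deviation) `σ`. -/
abbrev gaussMeasure (σ : ℝ) : Measure ℝ := gaussianReal 0 (NNReal.mk (σ ^ 2) (sq_nonneg σ))

/-- The density of the centred Gaussian of width `σ`. -/
def gaussDensity (σ : ℝ) : ℝ → ℝ := gaussianPDFReal 0 (NNReal.mk (σ ^ 2) (sq_nonneg σ))

/-- The cumulative distribution function of the centred Gaussian of width `σ`. -/
def gaussCdf (σ u : ℝ) : ℝ := cdf (gaussMeasure σ) u

section Gaussian

variable {σ : ℝ}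

@[fun_prop]
lemma continuous_gaussWeight (σ : ℝ) : Continuous (gaussWeight σ) := by
  unfold gaussWeight; fun_prop

lemma gaussWeight_pos (σ u : ℝ) : 0 < gaussWeight σ u := Real.exp_pos _

lemma abs_gaussWeight_le_one (σ u : ℝ) : |gaussWeight σ u| ≤ 1 := by
  rw [abs_of_pos (gaussWeight_pos σ u), gaussWeight, Real.exp_le_one_iff, neg_nonpos]
  positivity

lemma tendsto_gaussWeight (u : ℝ) : Tendsto (fun σ => gaussWeight σ u) atTop (𝓝 1) := by
  have h : Tendsto (fun σ : ℝ => 2 * σ ^ 2) atTop atTop :=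
    (tendsto_pow_atTop two_ne_zero).const_mul_atTop two_pos
  simpa [gaussWeight, Function.comp_def] using
    (Real.continuous_exp.tendsto _).comp (h.const_div_atTop (u ^ 2)).neg

lemma hasDerivAt_gaussPrimitive (σ u : ℝ) :
    HasDerivAt (gaussPrimitive σ) (gaussWeight σ u) u :=
  (continuous_gaussWeight σ).integral_hasStrictDerivAt 0 u |>.hasDerivAt

@[fun_prop]
lemma continuous_gaussPrimitive (σ : ℝ) : Continuous (gaussPrimitive σ) :=
  continuous_iff_continuousAt.2 fun u => (hasDerivAt_gaussPrimitive σ u).continuousAt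

lemma abs_gaussPrimitive_le (σ u : ℝ) : |gaussPrimitive σ u| ≤ |u| := by
  simpa [gaussPrimitive] using intervalIntegral.norm_integral_le_of_norm_le_const (a := 0) (b := u)
    (f := gaussWeight σ) fun r _ => abs_gaussWeight_le_one σ r

lemma tendsto_gaussPrimitive (u : ℝ) : Tendsto (fun σ => gaussPrimitive σ u) atTop (𝓝 u) := by
  have h : Tendsto (fun σ => gaussPrimitive σ u) atTop (𝓝 (∫ _ in (0 : ℝ)..u, (1 : ℝ))) :=
    intervalIntegral.tendsto_integral_filter_of_dominated_convergence (fun _ => (1 : ℝ))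
      (.of_forall fun σ => (continuous_gaussWeight σ).aestronglyMeasurable)
      (.of_forall fun σ => ae_of_all _ fun r _ => abs_gaussWeight_le_one σ r)
      intervalIntegrable_const (ae_of_all _ fun r _ => tendsto_gaussWeight r)
  simpa using h

lemma gaussDensity_eq (hσ : 0 < σ) (u : ℝ) :
    gaussDensity σ u = (√(2 * π) * σ)⁻¹ * gaussWeight σ u := by
  simp only [gaussDensity, gaussianPDFReal_def, gaussWeight, NNReal.coe_mk, sub_zero, neg_div]
  rw [Real.sqrt_mul (by positivity), Real.sqrt_sq hσ.le]

lemma husimiKernel_eq {σp σx : ℝ} (hp : 0 < σp) (hx : 0 < σx) (u v : ℝ) :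
    husimiKernel σp σx u v = gaussDensity σp u * gaussDensity σx v := by
  have hsqrt : √(2 * π) * √(2 * π) = 2 * π := Real.mul_self_sqrt (by positivity)
  have hnorm : 2 * π * σp * σx = √(2 * π) * σp * (√(2 * π) * σx) := by
    linear_combination (-σp * σx) * hsqrt
  rw [gaussDensity_eq hp, gaussDensity_eq hx, husimiKernel, hnorm, one_div, mul_inv,
    gaussWeight, gaussWeight, sub_eq_add_neg, Real.exp_add]
  ring

lemma gaussMeasure_eq_map (σ : ℝ) : gaussMeasure σ = stdGauss.map (σ * ·) := by
  rw [gaussianReal_map_const_mul, mul_zero, mul_one]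

lemma gaussVariance_ne_zero (hσ : σ ≠ 0) : NNReal.mk (σ ^ 2) (sq_nonneg σ) ≠ 0 := by
  simpa [← NNReal.coe_ne_zero] using hσ

lemma integral_gaussDensity_smul {E : Type*} [NormedAddCommGroup E] [NormedSpace ℝ E]
    (hσ : σ ≠ 0) (f : ℝ → E) :
    ∫ u, gaussDensity σ u • f u = ∫ z, f (σ * z) ∂stdGauss := by
  rw [gaussDensity, ← integral_gaussianReal_eq_integral_smul (gaussVariance_ne_zero hσ),
    show gaussianReal 0 _ = _ from gaussMeasure_eq_map σ]
  exact (Homeomorph.mulLeft₀ σ hσ).measurableEmbedding.integral_map f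

lemma setIntegral_Iic_gaussDensity (hσ : σ ≠ 0) (u : ℝ) :
    ∫ r in Iic u, gaussDensity σ r = gaussCdf σ u := by
  have hnn : 0 ≤ ∫ r in Iic u, gaussDensity σ r :=
    integral_nonneg fun r => gaussianPDFReal_nonneg _ _ r
  rw [gaussCdf, cdf_eq_real, measureReal_def,
    gaussianReal_apply_eq_integral _ (gaussVariance_ne_zero hσ)]
  exact (ENNReal.toReal_ofReal hnn).symm

lemma gaussCdf_zero (hσ : σ ≠ 0) : gaussCdf σ 0 = 1 / 2 := by
  have := nullSingletonClass_gaussianReal (μ := 0) (gaussVariance_ne_zero hσ)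
  have hsymm : (gaussMeasure σ).real (Iic 0) = (gaussMeasure σ).real (Ioi 0) := by
    have h := gaussianReal_map_neg (μ := 0) (v := NNReal.mk (σ ^ 2) (sq_nonneg σ))
    rw [neg_zero] at h
    conv_lhs => rw [gaussMeasure, ← h, map_measureReal_apply measurable_neg measurableSet_Iic]
    simp only [neg_preimage, neg_Iic, neg_zero]
    exact measureReal_congr Ioi_ae_eq_Ici.symm
  have htotal := probReal_add_probReal_compl (μ := gaussMeasure σ) (measurableSet_Iic (a := 0))
  rw [compl_Iic, ← hsymm] at htotal
  rw [gaussCdf, cdf_eq_real]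
  linarith

lemma integrable_gaussDensity (σ : ℝ) : Integrable (gaussDensity σ) :=
  integrable_gaussianPDFReal _ _

lemma gaussCdf_eq (hσ : 0 < σ) (u : ℝ) :
    gaussCdf σ u = 1 / 2 + (√(2 * π) * σ)⁻¹ * gaussPrimitive σ u := by
  have h := intervalIntegral.integral_Iic_sub_Iic (b := u)
    (integrable_gaussDensity σ).integrableOn (a := 0) (integrable_gaussDensity σ).integrableOn
  rw [setIntegral_Iic_gaussDensity hσ.ne', setIntegral_Iic_gaussDensity hσ.ne',
    gaussCdf_zero hσ.ne'] at h
  simp only [gaussDensity_eq hσ, intervalIntegral.integral_const_mul] at h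
  rw [gaussPrimitive]
  linarith

lemma hasDerivAt_gaussCdf (hσ : 0 < σ) (u : ℝ) :
    HasDerivAt (gaussCdf σ) (gaussDensity σ u) u := by
  rw [funext (gaussCdf_eq hσ), gaussDensity_eq hσ]
  exact ((hasDerivAt_gaussPrimitive σ u).const_mul _).const_add _

lemma abs_gaussCdf_le_one (σ u : ℝ) : |gaussCdf σ u| ≤ 1 :=
  abs_le.2 ⟨neg_one_lt_zero.le.trans (cdf_nonneg _ u), cdf_le_one _ u⟩

@[fun_prop]
lemma measurable_gaussCdf (σ : ℝ) : Measurable (gaussCdf σ) :=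
  (monotone_cdf (gaussMeasure σ)).measurable

end Gaussian

/-- Jointly continuous functions of `(p, x)` that decay in `p` faster than any power, uniformly
in `x`: the class of phase-space functions that is averaged against momentum kernels. -/
structure RapidDecay (f : ℝ → ℝ → ℝ) : Prop where
  continuous : Continuous (Function.uncurry f)
  bound : ∀ j : ℕ, ∃ C : ℝ, ∀ p x, |p| ^ j * |f p x| ≤ C

/-- Kernels in the momentum variable of at most linear growth. The constant is a parameter so that
families of kernels can be dominated uniformly. -/
structure LinearGrowth (c : ℝ) (k : ℝ → ℝ) : Prop where
  measurable : Measurable k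
  abs_le : ∀ q, |k q| ≤ c * (1 + |q|)

/-- The integral of `f(q, x - σ z)` against `k(q)` in `q` and a standard Gaussian in `z`: the form
in which all Gaussian convolutions of rapidly decaying phase-space functions are handled. -/
def gaussAvg (σ : ℝ) (k : ℝ → ℝ) (f : ℝ → ℝ → ℝ) (x : ℝ) : ℝ :=
  ∫ z : ℝ × ℝ, k z.1 * f z.1 (x - σ * z.2) ∂(volume.prod stdGauss)

/-- The Gaussian average in position of the momentum marginal of `f`. -/
abbrev gaussMarginal (σ : ℝ) (f : ℝ → ℝ → ℝ) : ℝ → ℝ := gaussAvg σ (fun _ => 1) f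

section Kernels

variable {c : ℝ} {k : ℝ → ℝ}

lemma LinearGrowth.of_abs_le (hk : Measurable k) (h : ∀ q, |k q| ≤ c) : LinearGrowth c k where
  measurable := hk
  abs_le q := (h q).trans <|
    le_mul_of_one_le_right ((abs_nonneg _).trans (h 0)) (by linarith [abs_nonneg q])

lemma LinearGrowth.const_mul (hk : LinearGrowth c k) (a : ℝ) :
    LinearGrowth (|a| * c) (fun q => a * k q) where
  measurable := hk.measurable.const_mul a
  abs_le q := by
    rw [abs_mul, mul_assoc]
    exact mul_le_mul_of_nonneg_left (hk.abs_le q) (abs_nonneg a)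

lemma linearGrowth_one : LinearGrowth 1 (fun _ => 1) :=
  .of_abs_le measurable_const fun _ => abs_one.le

lemma linearGrowth_gaussWeight (σ p : ℝ) : LinearGrowth 1 (fun q => gaussWeight σ (p - q)) :=
  .of_abs_le (by fun_prop) fun _ => abs_gaussWeight_le_one _ _

lemma linearGrowth_gaussCdf (σ p : ℝ) : LinearGrowth 1 (fun q => gaussCdf σ (p - q)) :=
  .of_abs_le (by fun_prop) fun _ => abs_gaussCdf_le_one _ _

lemma linearGrowth_gaussDensity {σ : ℝ} (hσ : 0 < σ) (p : ℝ) :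
    LinearGrowth (|(√(2 * π) * σ)⁻¹| * 1) (fun q => gaussDensity σ (p - q)) := by
  simpa only [gaussDensity_eq hσ] using (linearGrowth_gaussWeight σ p).const_mul _

lemma linearGrowth_gaussPrimitive (σ p : ℝ) :
    LinearGrowth (1 + |p|) (fun q => gaussPrimitive σ (p - q)) where
  measurable := by fun_prop
  abs_le q := (abs_gaussPrimitive_le _ _).trans <| (abs_sub _ _).trans <| by
    nlinarith [mul_nonneg (abs_nonneg p) (abs_nonneg q)]

end Kernels

section GaussAvg

variable {c σ : ℝ} {k : ℝ → ℝ} {f g : ℝ → ℝ → ℝ}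

lemma RapidDecay.momentum_mul (hf : RapidDecay f) : RapidDecay (fun p x => p * f p x) where
  continuous := continuous_fst.mul hf.continuous
  bound j := by simpa only [abs_mul, ← mul_assoc, ← pow_succ] using hf.bound (j + 1)

lemma RapidDecay.add (hf : RapidDecay f) (hg : RapidDecay g) :
    RapidDecay (fun p x => f p x + g p x) where
  continuous := hf.continuous.add hg.continuous
  bound j := by
    obtain ⟨C, hC⟩ := hf.bound j
    obtain ⟨D, hD⟩ := hg.bound j
    refine ⟨C + D, fun p x => le_trans ?_ (add_le_add (hC p x) (hD p x))⟩
    rw [← mul_add]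
    exact mul_le_mul_of_nonneg_left (abs_add_le _ _) (by positivity)

lemma RapidDecay.exists_integrable_bound (hf : RapidDecay f) :
    ∃ b : ℝ → ℝ, Integrable b ∧ ∀ p x, (1 + |p|) * |f p x| ≤ b p := by
  obtain ⟨C₀, h₀⟩ := hf.bound 0
  obtain ⟨C₁, h₁⟩ := hf.bound 1
  obtain ⟨C₂, h₂⟩ := hf.bound 2
  obtain ⟨C₃, h₃⟩ := hf.bound 3
  refine ⟨fun p => (C₀ + C₁ + C₂ + C₃) * (1 + p ^ 2)⁻¹,
    integrable_inv_one_add_sq.const_mul _, fun p x => ?_⟩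
  beta_reduce
  rw [← div_eq_mul_inv, le_div_iff₀ (by positivity), ← sq_abs p]
  linear_combination h₀ p x + h₁ p x + h₂ p x + h₃ p x

lemma RapidDecay.integrable (hf : RapidDecay f) (x : ℝ) : Integrable (fun p => f p x) := by
  obtain ⟨b, hb, hfb⟩ := hf.exists_integrable_bound
  refine hb.mono' (hf.continuous.uncurry_right x).aestronglyMeasurable
    (ae_of_all _ fun p => le_trans ?_ (hfb p x))
  exact le_mul_of_one_le_left (abs_nonneg _) (le_add_of_nonneg_right (abs_nonneg p))

lemma LinearGrowth.norm_mul_le {b : ℝ → ℝ} (hk : LinearGrowth c k)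
    (hb : ∀ p x, (1 + |p|) * |f p x| ≤ b p) (q y : ℝ) : ‖k q * f q y‖ ≤ |c| * b q := by
  calc ‖k q * f q y‖ = |k q| * |f q y| := norm_mul _ _
    _ ≤ |c| * (1 + |q|) * |f q y| := by
        gcongr
        exact (hk.abs_le q).trans (by gcongr; exact le_abs_self c)
    _ = |c| * ((1 + |q|) * |f q y|) := mul_assoc _ _ _
    _ ≤ |c| * b q := by gcongr; exact hb q y

lemma RapidDecay.aestronglyMeasurable_gaussAvg (hf : RapidDecay f) (hk : Measurable k)
    (σ x : ℝ) : AEStronglyMeasurable (fun z : ℝ × ℝ => k z.1 * f z.1 (x - σ * z.2))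
      (volume.prod stdGauss) := by
  have h : Continuous fun z : ℝ × ℝ => f z.1 (x - σ * z.2) :=
    hf.continuous.comp (g := Function.uncurry f)
      (by fun_prop : Continuous fun z : ℝ × ℝ => (z.1, x - σ * z.2))
  exact ((hk.comp measurable_fst).mul h.measurable).aestronglyMeasurable

lemma integrable_gaussAvg (hk : LinearGrowth c k) (hf : RapidDecay f) (σ x : ℝ) :
    Integrable (fun z : ℝ × ℝ => k z.1 * f z.1 (x - σ * z.2)) (volume.prod stdGauss) := by
  obtain ⟨b, hb, hfb⟩ := hf.exists_integrable_bound
  exact ((hb.comp_fst stdGauss).const_mul |c|).mono'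
    (hf.aestronglyMeasurable_gaussAvg hk.measurable σ x)
    (ae_of_all _ fun z => hk.norm_mul_le hfb z.1 _)

lemma gaussAvg_eq_integral_integral (hk : LinearGrowth c k) (hf : RapidDecay f) (σ x : ℝ) :
    gaussAvg σ k f x = ∫ z, (∫ q, k q * f q (x - σ * z)) ∂stdGauss :=
  integral_prod_symm _ (integrable_gaussAvg hk hf σ x)

lemma gaussAvg_const_mul (a σ : ℝ) (k : ℝ → ℝ) (f : ℝ → ℝ → ℝ) (x : ℝ) :
    gaussAvg σ (fun q => a * k q) f x = a * gaussAvg σ k f x := by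
  simp only [gaussAvg, mul_assoc, integral_const_mul]

lemma gaussAvg_add {c' : ℝ} {k' : ℝ → ℝ} (hk : LinearGrowth c k) (hk' : LinearGrowth c' k')
    (hf : RapidDecay f) (σ x : ℝ) :
    gaussAvg σ (fun q => k q + k' q) f x = gaussAvg σ k f x + gaussAvg σ k' f x := by
  simp only [gaussAvg, add_mul]
  exact integral_add (integrable_gaussAvg hk hf σ x) (integrable_gaussAvg hk' hf σ x)

lemma hasDerivAt_gaussAvg (hk : LinearGrowth c k) (hf : RapidDecay f) (hg : RapidDecay g)
    (hd : ∀ p x, HasDerivAt (f p) (g p x) x) (σ x : ℝ) :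
    HasDerivAt (gaussAvg σ k f) (gaussAvg σ k g x) x := by
  obtain ⟨b, hb, hgb⟩ := hg.exists_integrable_bound
  refine (hasDerivAt_integral_of_dominated_loc_of_deriv_le (s := univ)
    (F' := fun x (z : ℝ × ℝ) => k z.1 * g z.1 (x - σ * z.2)) univ_mem
    (.of_forall fun y => hf.aestronglyMeasurable_gaussAvg hk.measurable σ y)
    (integrable_gaussAvg hk hf σ x) (hg.aestronglyMeasurable_gaussAvg hk.measurable σ x)
    (ae_of_all _ fun z y _ => hk.norm_mul_le hgb z.1 (y - σ * z.2))
    ((hb.comp_fst stdGauss).const_mul |c|) (ae_of_all _ fun z y _ => ?_)).2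
  exact ((hd z.1 (y - σ * z.2)).comp_sub_const y (σ * z.2)).const_mul _

lemma hasDerivAt_gaussAvg_kernel {c' : ℝ} {k k' : ℝ → ℝ → ℝ} (hk : ∀ p, LinearGrowth c (k p))
    (hk' : ∀ p, LinearGrowth c' (k' p)) (hd : ∀ p q, HasDerivAt (fun p => k p q) (k' p q) p)
    (hf : RapidDecay f) (p x : ℝ) :
    HasDerivAt (fun p => gaussAvg σ (k p) f x) (gaussAvg σ (k' p) f x) p := by
  obtain ⟨b, hb, hfb⟩ := hf.exists_integrable_bound
  exact (hasDerivAt_integral_of_dominated_loc_of_deriv_le (s := univ)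
    (F' := fun p (z : ℝ × ℝ) => k' p z.1 * f z.1 (x - σ * z.2)) univ_mem
    (.of_forall fun p => hf.aestronglyMeasurable_gaussAvg (hk p).measurable σ x)
    (integrable_gaussAvg (hk p) hf σ x)
    (hf.aestronglyMeasurable_gaussAvg (hk' p).measurable σ x)
    (ae_of_all _ fun z p _ => (hk' p).norm_mul_le hfb z.1 (x - σ * z.2))
    ((hb.comp_fst stdGauss).const_mul |c'|)
    (ae_of_all _ fun z p _ => (hd p z.1).mul_const _)).2

lemma tendsto_gaussAvg {ι : Type*} {l : Filter ι} [l.IsCountablyGenerated] {σ : ι → ℝ}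
    {K : ι → ℝ → ℝ} (hσ : Tendsto σ l (𝓝 0)) (hK : ∀ i, LinearGrowth c (K i))
    (hlim : ∀ q, Tendsto (fun i => K i q) l (𝓝 (k q))) (hf : RapidDecay f) (x : ℝ) :
    Tendsto (fun i => gaussAvg (σ i) (K i) f x) l (𝓝 (∫ q, k q * f q x)) := by
  obtain ⟨b, hb, hfb⟩ := hf.exists_integrable_bound
  have hproduct : ∫ z : ℝ × ℝ, k z.1 * f z.1 x ∂(volume.prod stdGauss) = ∫ q, k q * f q x := by
    simpa using integral_fun_fst (μ := volume) (ν := stdGauss) fun q => k q * f q x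
  rw [← hproduct]
  refine tendsto_integral_filter_of_dominated_convergence (fun z : ℝ × ℝ => |c| * b z.1)
    (.of_forall fun i => hf.aestronglyMeasurable_gaussAvg (hK i).measurable _ x)
    (.of_forall fun i => ae_of_all _ fun z => (hK i).norm_mul_le hfb z.1 _)
    ((hb.comp_fst stdGauss).const_mul |c|) (ae_of_all _ fun z => (hlim z.1).mul ?_)
  have hpoint : Tendsto (fun i => (z.1, x - σ i * z.2)) l (𝓝 (z.1, x)) :=
    tendsto_const_nhds.prodMk_nhds (by simpa using tendsto_const_nhds.sub (hσ.mul_const z.2))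
  exact (hf.continuous.tendsto (z.1, x)).comp hpoint

end GaussAvg

section Smooth

variable {σp σx : ℝ} {f g : ℝ → ℝ → ℝ}

lemma smooth_eq_gaussAvg (hp : 0 < σp) (hx : 0 < σx) (hf : RapidDecay f) (p x : ℝ) :
    smooth σp σx f p x = gaussAvg σx (fun q => gaussDensity σp (p - q)) f x := by
  rw [gaussAvg_eq_integral_integral (linearGrowth_gaussDensity hp p) hf,
    ← integral_gaussDensity_smul hx.ne' fun u => ∫ q, gaussDensity σp (p - q) * f q (x - u),
    smooth, ← integral_sub_left_eq_self _ volume x]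
  congr 1 with u
  rw [smul_eq_mul, ← integral_const_mul]
  congr 1 with q
  rw [husimiKernel_eq hp hx, sub_sub_cancel]
  ring

lemma smooth_eq_gaussAvg_gaussWeight (hp : 0 < σp) (hx : 0 < σx) (hf : RapidDecay f) (p x : ℝ) :
    smooth σp σx f p x =
      (√(2 * π) * σp)⁻¹ * gaussAvg σx (fun q => gaussWeight σp (p - q)) f x := by
  simp only [smooth_eq_gaussAvg hp hx hf, gaussDensity_eq hp, gaussAvg_const_mul]

lemma hasDerivAt_smooth (hp : 0 < σp) (hx : 0 < σx) (hf : RapidDecay f) (hg : RapidDecay g)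
    (hd : ∀ p x, HasDerivAt (f p) (g p x) x) (p x : ℝ) :
    HasDerivAt (smooth σp σx f p) (smooth σp σx g p x) x := by
  simp only [funext (smooth_eq_gaussAvg hp hx hf p), smooth_eq_gaussAvg hp hx hg]
  exact hasDerivAt_gaussAvg (linearGrowth_gaussDensity hp p) hf hg hd σx x

lemma hasDerivAt_gaussAvg_gaussCdf (hp : 0 < σp) (hx : 0 < σx) (hf : RapidDecay f) (p x : ℝ) :
    HasDerivAt (fun p => gaussAvg σx (fun q => gaussCdf σp (p - q)) f x)
      (smooth σp σx f p x) p := by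
  rw [smooth_eq_gaussAvg hp hx hf]
  exact hasDerivAt_gaussAvg_kernel (linearGrowth_gaussCdf σp) (linearGrowth_gaussDensity hp)
    (fun p q => (hasDerivAt_gaussCdf hp (p - q)).comp_sub_const p q) hf p x

lemma gaussAvg_gaussCdf (hp : 0 < σp) (hf : RapidDecay f) (p x : ℝ) :
    gaussAvg σx (fun q => gaussCdf σp (p - q)) f x = 1 / 2 * gaussMarginal σx f x +
      (√(2 * π) * σp)⁻¹ * gaussAvg σx (fun q => gaussPrimitive σp (p - q)) f x := by
  simp only [gaussMarginal, ← gaussAvg_const_mul, gaussCdf_eq hp]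
  rw [← gaussAvg_add (linearGrowth_one.const_mul _)
    ((linearGrowth_gaussPrimitive σp p).const_mul _) hf]
  simp only [mul_one]

lemma integrable_sub_mul_prod {α : Type*} [MeasurableSpace α] {ν : Measure α} [SFinite ν]
    {d : ℝ → ℝ} {u h : α → ℝ} (hd : Integrable d) (hu : Integrable u ν) (hh : Measurable h) :
    Integrable (fun w : ℝ × α => d (w.1 - h w.2) * u w.2) (volume.prod ν) := by
  -- The shear `(a, r) ↦ (a, r - h a)` reduces the claim to a product of two functions.
  have hshear : MeasurePreserving (fun w : α × ℝ => (w.1, w.2 - h w.1))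
      (ν.prod volume) (ν.prod volume) :=
    (MeasurePreserving.id ν).skew_product (g := fun a r => r - h a) (by fun_prop)
      (ae_of_all _ fun a => (measurePreserving_sub_right volume (h a)).map_eq)
  have hint := hshear.integrable_comp_of_integrable (hu.mul_prod hd)
  simpa only [Function.comp_def, mul_comm, Prod.fst_swap, Prod.snd_swap] using hint.swap

lemma setIntegral_smooth (hp : 0 < σp) (hx : 0 < σx) (hf : RapidDecay f) (s : Set ℝ) (x : ℝ) :
    ∫ p in s, smooth σp σx f p x =
      gaussAvg σx (fun q => ∫ p in s, gaussDensity σp (p - q)) f x := by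
  have hint : Integrable (fun w : ℝ × ℝ × ℝ =>
      gaussDensity σp (w.1 - w.2.1) * f w.2.1 (x - σx * w.2.2))
      ((volume.restrict s).prod (volume.prod stdGauss)) := by
    have hf' := integrable_gaussAvg linearGrowth_one hf σx x
    simp only [one_mul] at hf'
    exact (integrable_sub_mul_prod (integrable_gaussDensity σp) hf' measurable_fst).mono_measure
      (Measure.prod_mono Measure.restrict_le_self le_rfl)
  simp only [smooth_eq_gaussAvg hp hx hf, gaussAvg]
  rw [integral_integral_swap hint]
  simp only [integral_mul_const]

lemma integral_smooth (hp : 0 < σp) (hx : 0 < σx) (hf : RapidDecay f) (x : ℝ) :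
    ∫ p, smooth σp σx f p x = gaussMarginal σx f x := by
  have hmass (q : ℝ) : ∫ p, gaussDensity σp (p - q) = 1 := by
    rw [integral_sub_right_eq_self]
    exact integral_gaussianPDFReal_eq_one _ (gaussVariance_ne_zero hp.ne')
  simpa only [Measure.restrict_univ, hmass] using setIntegral_smooth hp hx hf univ x

lemma setIntegral_Iic_smooth (hp : 0 < σp) (hx : 0 < σx) (hf : RapidDecay f) (p x : ℝ) :
    ∫ q in Iic p, smooth σp σx f q x = gaussAvg σx (fun q => gaussCdf σp (p - q)) f x := by
  rw [setIntegral_smooth hp hx hf]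
  congr 1 with q
  have h := (measurePreserving_sub_right volume q).setIntegral_preimage_emb
    (MeasurableEquiv.subRight q).measurableEmbedding (gaussDensity σp) (Iic (p - q))
  rwa [preimage_sub_const_Iic, sub_add_cancel, setIntegral_Iic_gaussDensity hp.ne'] at h

end Smooth

section BohmianLimit

variable {f : ℝ → ℝ → ℝ}

instance : bohmianLimit.IsCountablyGenerated := by unfold bohmianLimit; infer_instance

lemma eventually_bohmianLimit_pos : ∀ᶠ σ : ℝ × ℝ in bohmianLimit, 0 < σ.1 ∧ 0 < σ.2 :=
  (eventually_gt_atTop 0).prod_mk self_mem_nhdsWithin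

lemma tendsto_fst_bohmianLimit : Tendsto Prod.fst bohmianLimit (atTop : Filter ℝ) := tendsto_fst

lemma tendsto_snd_bohmianLimit : Tendsto Prod.snd bohmianLimit (𝓝 (0 : ℝ)) :=
  tendsto_snd.mono_right nhdsWithin_le_nhds

lemma tendsto_gaussMarginal (hf : RapidDecay f) (x : ℝ) :
    Tendsto (fun σ => gaussMarginal σ.2 f x) bohmianLimit (𝓝 (∫ q, f q x)) := by
  simpa only [one_mul] using tendsto_gaussAvg tendsto_snd_bohmianLimit (fun _ => linearGrowth_one)
    (fun _ => tendsto_const_nhds) hf x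

lemma tendsto_smooth (hf : RapidDecay f) (p x : ℝ) :
    Tendsto (fun σ => √(2 * π) * σ.1 * smooth σ.1 σ.2 f p x) bohmianLimit
      (𝓝 (∫ q, f q x)) := by
  have h := tendsto_gaussAvg tendsto_snd_bohmianLimit
    (fun σ => linearGrowth_gaussWeight σ.1 p)
    (fun q => (tendsto_gaussWeight (p - q)).comp tendsto_fst_bohmianLimit) hf x
  simp only [one_mul] at h
  refine h.congr' ?_
  filter_upwards [eventually_bohmianLimit_pos] with σ ⟨hp, hx⟩
  rw [smooth_eq_gaussAvg_gaussWeight hp hx hf, mul_inv_cancel_left₀ (by positivity)]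

lemma tendsto_gaussAvg_gaussPrimitive (hf : RapidDecay f) (p x : ℝ) :
    Tendsto (fun σ => gaussAvg σ.2 (fun q => gaussPrimitive σ.1 (p - q)) f x) bohmianLimit
      (𝓝 (p * (∫ q, f q x) - ∫ q, q * f q x)) := by
  have hmoment : ∫ q, (p - q) * f q x = p * (∫ q, f q x) - ∫ q, q * f q x := by
    simp only [sub_mul]
    rw [integral_sub ((hf.integrable x).const_mul p) (hf.momentum_mul.integrable x),
      integral_const_mul]
  rw [← hmoment]
  exact tendsto_gaussAvg tendsto_snd_bohmianLimit (fun σ => linearGrowth_gaussPrimitive σ.1 p)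
    (fun q => (tendsto_gaussPrimitive (p - q)).comp tendsto_fst_bohmianLimit) hf x

end BohmianLimit

/-- The unimodular factor `exp(-iθ)` of the Wigner transform. -/
def phaseFactor (θ : ℝ) : ℂ := Complex.exp (-Complex.I * (θ : ℂ))

lemma norm_phaseFactor (θ : ℝ) : ‖phaseFactor θ‖ = 1 := by
  rw [phaseFactor, neg_mul, ← mul_neg, ← Complex.ofReal_neg]
  exact Complex.norm_exp_I_mul_ofReal _

@[fun_prop]
lemma continuous_phaseFactor : Continuous phaseFactor := by
  unfold phaseFactor
  fun_prop

lemma phaseFactor_zero : phaseFactor 0 = 1 := by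
  simp [phaseFactor]

lemma phaseFactor_add (θ θ' : ℝ) : phaseFactor (θ + θ') = phaseFactor θ * phaseFactor θ' := by
  rw [phaseFactor, phaseFactor, phaseFactor, ← Complex.exp_add, Complex.ofReal_add, mul_add]

lemma phaseFactor_neg (θ : ℝ) : phaseFactor (-θ) = Complex.exp (Complex.I * (θ : ℂ)) := by
  simp [phaseFactor]

lemma conj_phaseFactor (θ : ℝ) : starRingEnd ℂ (phaseFactor θ) = phaseFactor (-θ) := by
  simp [phaseFactor, ← Complex.exp_conj]

lemma integral_mul_phaseFactor (f : ℝ → ℂ) (a p : ℝ) :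
    ∫ y, f y * phaseFactor (p * y / a) = 𝓕 f (p / (2 * π * a)) := by
  rw [Real.fourier_real_eq_integral_exp_smul]
  congr 1 with y
  rw [smul_eq_mul, mul_comm, phaseFactor]
  congr 2
  rw [show -2 * π * y * (p / (2 * π * a)) = -(p * y / a) by field_simp]
  push_cast
  ring

lemma integral_fourier_mul_phaseFactor {f : ℝ → ℂ} {a : ℝ} (hf : Integrable f)
    (hf' : Integrable (𝓕 f)) (hc : Continuous f) (ha : 0 < a) (y : ℝ) :
    ∫ p, 𝓕 f (p / (2 * π * a)) * phaseFactor (-(p * y / a)) = ((2 * π * a : ℝ) : ℂ) * f y := by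
  have hpos : 0 < 2 * π * a := by positivity
  calc ∫ p, 𝓕 f (p / (2 * π * a)) * phaseFactor (-(p * y / a))
      = ∫ p, (fun w => Complex.exp ((2 * π * (w * y) : ℝ) * Complex.I) • 𝓕 f w)
          (p / (2 * π * a)) := by
        congr 1 with p
        beta_reduce
        rw [smul_eq_mul, mul_comm, phaseFactor_neg, mul_comm Complex.I,
          show 2 * π * (p / (2 * π * a) * y) = p * y / a by field_simp]
    _ = ((2 * π * a : ℝ) : ℂ) * 𝓕⁻ (𝓕 f) y := by
        rw [Measure.integral_comp_div (fun w : ℝ =>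
            Complex.exp ((2 * π * (w * y) : ℝ) * Complex.I) • 𝓕 f w) (2 * π * a),
          abs_of_pos hpos, Complex.real_smul, Real.fourierInv_eq']
        simp only [RCLike.inner_apply, conj_trivial, mul_comm y]
    _ = _ := by rw [hf.fourierInv_fourier_eq hf' hc.continuousAt]

/-- Jointly continuous functions of `(x, y)` that are `O((1 + y²)⁻¹)` uniformly in `x`: the class
of off-diagonal functions whose Fourier transform in `y` is taken. -/
structure QuadDecay (F : ℝ → ℝ → ℂ) : Prop where
  continuous : Continuous (Function.uncurry F)
  bound : ∃ C : ℝ, ∀ x y, ‖F x y‖ ≤ C * (1 + y ^ 2)⁻¹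

/-- The Fourier transform in the second variable, in the normalisation of the Wigner function. -/
def partialFourier (hbar : ℝ) (F : ℝ → ℝ → ℂ) (p x : ℝ) : ℂ :=
  ((1 / (2 * π * hbar) : ℝ) : ℂ) * ∫ y, F x y * phaseFactor (p * y / hbar)

lemma partialFourier_eq_fourier (hbar : ℝ) (F : ℝ → ℝ → ℂ) (p x : ℝ) :
    partialFourier hbar F p x =
      ((1 / (2 * π * hbar) : ℝ) : ℂ) * 𝓕 (F x) (p / (2 * π * hbar)) := by
  rw [partialFourier, integral_mul_phaseFactor]

lemma partialFourier_const_mul (hbar : ℝ) (c : ℂ) (F : ℝ → ℝ → ℂ) (p x : ℝ) :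
    partialFourier hbar (fun x y => c * F x y) p x = c * partialFourier hbar F p x := by
  simp only [partialFourier, mul_assoc c, integral_const_mul]
  ring

namespace QuadDecay

variable {F G : ℝ → ℝ → ℂ} {hbar : ℝ}

lemma add (hF : QuadDecay F) (hG : QuadDecay G) : QuadDecay (fun x y => F x y + G x y) where
  continuous := hF.continuous.add hG.continuous
  bound := by
    obtain ⟨C, hC⟩ := hF.bound
    obtain ⟨D, hD⟩ := hG.bound
    refine ⟨C + D, fun x y => (norm_add_le _ _).trans ?_⟩
    rw [add_mul]
    exact add_le_add (hC x y) (hD x y)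

lemma const_mul (hF : QuadDecay F) (c : ℂ) : QuadDecay (fun x y => c * F x y) where
  continuous := continuous_const.mul hF.continuous
  bound := by
    obtain ⟨C, hC⟩ := hF.bound
    refine ⟨‖c‖ * C, fun x y => ?_⟩
    rw [norm_mul, mul_assoc]
    exact mul_le_mul_of_nonneg_left (hC x y) (norm_nonneg c)

lemma sub (hF : QuadDecay F) (hG : QuadDecay G) : QuadDecay (fun x y => F x y - G x y) := by
  simpa only [neg_one_mul, ← sub_eq_add_neg] using hF.add (hG.const_mul (-1))

lemma continuous_right (hF : QuadDecay F) (x : ℝ) : Continuous (F x) :=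
  hF.continuous.uncurry_left x

lemma integrable (hF : QuadDecay F) (x : ℝ) : Integrable (F x) := by
  obtain ⟨C, hC⟩ := hF.bound
  exact (integrable_inv_one_add_sq.const_mul C).mono' (hF.continuous_right x).aestronglyMeasurable
    (ae_of_all _ (hC x))

lemma integrable_mul_phaseFactor (hF : QuadDecay F) (p x : ℝ) :
    Integrable (fun y => F x y * phaseFactor (p * y / hbar)) :=
  (hF.integrable x).mul_bdd (c := 1) (by fun_prop) (ae_of_all _ fun _ => (norm_phaseFactor _).le)

lemma continuous_partialFourier (hF : QuadDecay F) :
    Continuous (Function.uncurry (partialFourier hbar F)) := by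
  obtain ⟨C, hC⟩ := hF.bound
  refine continuous_const.mul (continuous_of_dominated (bound := fun y => C * (1 + y ^ 2)⁻¹)
    (fun z => (hF.integrable_mul_phaseFactor z.1 z.2).aestronglyMeasurable)
    (fun z => ae_of_all _ fun y => ?_) (integrable_inv_one_add_sq.const_mul C)
    (ae_of_all _ fun y => ?_))
  · rw [norm_mul, norm_phaseFactor, mul_one]
    exact hC _ _
  · have : Continuous fun z : ℝ × ℝ => F z.2 y :=
      (hF.continuous.uncurry_right y).comp continuous_snd
    exact this.mul (by fun_prop)

lemma norm_partialFourier_le (hF : QuadDecay F) :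
    ∃ C, ∀ p x, ‖partialFourier hbar F p x‖ ≤ C := by
  obtain ⟨C, hC⟩ := hF.bound
  refine ⟨|1 / (2 * π * hbar)| * ∫ y : ℝ, C * (1 + y ^ 2)⁻¹, fun p x => ?_⟩
  rw [partialFourier, norm_mul, Complex.norm_real, Real.norm_eq_abs]
  refine mul_le_mul_of_nonneg_left (norm_integral_le_of_norm_le
    (integrable_inv_one_add_sq.const_mul C) (ae_of_all _ fun y => ?_)) (abs_nonneg _)
  rw [norm_mul, norm_phaseFactor, mul_one]
  exact hC x y

lemma partialFourier_add (hF : QuadDecay F) (hG : QuadDecay G) (p x : ℝ) :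
    partialFourier hbar (fun x y => F x y + G x y) p x =
      partialFourier hbar F p x + partialFourier hbar G p x := by
  simp only [partialFourier, add_mul]
  rw [integral_add (hF.integrable_mul_phaseFactor p x) (hG.integrable_mul_phaseFactor p x),
    mul_add]

lemma partialFourier_sub (hF : QuadDecay F) (hG : QuadDecay G) (p x : ℝ) :
    partialFourier hbar (fun x y => F x y - G x y) p x =
      partialFourier hbar F p x - partialFourier hbar G p x := by
  simp only [partialFourier, sub_mul]
  rw [integral_sub (hF.integrable_mul_phaseFactor p x) (hG.integrable_mul_phaseFactor p x),
    mul_sub]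

lemma hasDerivAt_partialFourier (hF : QuadDecay F) (hG : QuadDecay G)
    (hd : ∀ x y, HasDerivAt (fun x => F x y) (G x y) x) (p x : ℝ) :
    HasDerivAt (partialFourier hbar F p) (partialFourier hbar G p x) x := by
  obtain ⟨C, hC⟩ := hG.bound
  refine HasDerivAt.const_mul _ (hasDerivAt_integral_of_dominated_loc_of_deriv_le (s := univ)
    (bound := fun y => C * (1 + y ^ 2)⁻¹)
    (F' := fun x y => G x y * phaseFactor (p * y / hbar)) univ_mem
    (.of_forall fun z => (hF.integrable_mul_phaseFactor p z).aestronglyMeasurable)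
    (hF.integrable_mul_phaseFactor p x) (hG.integrable_mul_phaseFactor p x).aestronglyMeasurable
    (ae_of_all _ fun y z _ => ?_) (integrable_inv_one_add_sq.const_mul C)
    (ae_of_all _ fun y z _ => (hd z y).mul_const _)).2
  rw [norm_mul, norm_phaseFactor, mul_one]
  exact hC z y

lemma momentum_mul_partialFourier (hb : hbar ≠ 0) (hF : QuadDecay F) (hG : QuadDecay G)
    (hd : ∀ x y, HasDerivAt (F x) (G x y) y) (p x : ℝ) :
    (p : ℂ) * partialFourier hbar F p x = -Complex.I * hbar * partialFourier hbar G p x := by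
  have hderiv : deriv (F x) = G x := funext fun y => (hd x y).deriv
  have h : 𝓕 (deriv (F x)) (p / (2 * π * hbar)) = _ := congrFun (Real.fourier_deriv
    (hF.integrable x) (fun y => (hd x y).differentiableAt) (hderiv ▸ hG.integrable x)) _
  have hbc : (hbar : ℂ) ≠ 0 := by exact_mod_cast hb
  rw [partialFourier_eq_fourier, partialFourier_eq_fourier, ← hderiv, h, smul_eq_mul]
  push_cast
  field_simp
  linear_combination p * 𝓕 (F x) (p / (2 * π * hbar)) * Complex.I_sq

lemma integral_partialFourier_mul_phaseFactor (hb : 0 < hbar) (hF : QuadDecay F) {x : ℝ}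
    (hI : Integrable (fun p => partialFourier hbar F p x)) (y : ℝ) :
    ∫ p, partialFourier hbar F p x * phaseFactor (-(p * y / hbar)) = F x y := by
  have hpos : 0 < 2 * π * hbar := by positivity
  have hne : ((2 * π * hbar : ℝ) : ℂ) ≠ 0 := by exact_mod_cast hpos.ne'
  simp only [partialFourier_eq_fourier] at hI ⊢
  have hfourier : Integrable (𝓕 (F x)) := by
    refine ((hI.const_mul ((2 * π * hbar : ℝ) : ℂ)).comp_mul_left' hpos.ne').congr
      (ae_of_all _ fun w => ?_)
    beta_reduce
    rw [mul_div_cancel_left₀ w hpos.ne', ← mul_assoc, ← Complex.ofReal_mul,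
      mul_one_div_cancel hpos.ne', Complex.ofReal_one, one_mul]
  simp only [mul_assoc (Complex.ofReal _), integral_const_mul]
  rw [integral_fourier_mul_phaseFactor (hF.integrable x) hfourier (hF.continuous_right x) hb,
    Complex.ofReal_div, Complex.ofReal_one, one_div, inv_mul_cancel_left₀ hne]

end QuadDecay

section CrossDensity

/-- The derivative of a Schwartz function, as a Schwartz function. -/
abbrev sderiv (φ : 𝓢(ℝ, ℂ)) : 𝓢(ℝ, ℂ) := derivCLM ℂ ℂ φ

lemma hasDerivAt_sderiv (φ : 𝓢(ℝ, ℂ)) (x : ℝ) : HasDerivAt φ (sderiv φ x) x := by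
  rw [derivCLM_apply]
  exact φ.hasDerivAt x

/-- The off-diagonal density `φ*(x - y/2) ψ(x + y/2)` of a pair of wave functions, in the mean
position `x` and the relative position `y`. -/
def crossDensity (φ ψ : ℝ → ℂ) (x y : ℝ) : ℂ :=
  starRingEnd ℂ (φ (x - y / 2)) * ψ (x + y / 2)

lemma continuous_crossDensity {φ ψ : ℝ → ℂ} (hφ : Continuous φ) (hψ : Continuous ψ) :
    Continuous (Function.uncurry (crossDensity φ ψ)) :=
  (by fun_prop : Continuous fun z : ℝ × ℝ =>
    starRingEnd ℂ (φ (z.1 - z.2 / 2)) * ψ (z.1 + z.2 / 2))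

lemma inv_one_add_sq_mul_le (x y : ℝ) :
    (1 + (x - y / 2) ^ 2)⁻¹ * (1 + (x + y / 2) ^ 2)⁻¹ ≤ 2 * (1 + y ^ 2)⁻¹ := by
  rw [← mul_inv, ← div_eq_mul_inv, inv_le_comm₀ (by positivity) (by positivity), inv_div,
    div_le_iff₀ two_pos]
  nlinarith [sq_nonneg x, sq_nonneg ((x - y / 2) * (x + y / 2))]

lemma quadDecay_crossDensity_of_bound {φ ψ : ℝ → ℂ} (hφ : Continuous φ) (hψ : Continuous ψ)
    {C D : ℝ} (hC : ∀ x, ‖φ x‖ ≤ C * (1 + x ^ 2)⁻¹) (hD : ∀ x, ‖ψ x‖ ≤ D * (1 + x ^ 2)⁻¹) :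
    QuadDecay (crossDensity φ ψ) where
  continuous := continuous_crossDensity hφ hψ
  bound := by
    have hC0 : 0 ≤ C := by simpa using (norm_nonneg _).trans (hC 0)
    have hD0 : 0 ≤ D := by simpa using (norm_nonneg _).trans (hD 0)
    refine ⟨C * D * 2, fun x y => ?_⟩
    calc ‖crossDensity φ ψ x y‖ = ‖φ (x - y / 2)‖ * ‖ψ (x + y / 2)‖ := by
          rw [crossDensity, norm_mul, RCLike.norm_conj]
      _ ≤ (C * (1 + (x - y / 2) ^ 2)⁻¹) * (D * (1 + (x + y / 2) ^ 2)⁻¹) := by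
          gcongr
          exacts [hC _, hD _]
      _ = C * D * ((1 + (x - y / 2) ^ 2)⁻¹ * (1 + (x + y / 2) ^ 2)⁻¹) := mul_mul_mul_comm _ _ _ _
      _ ≤ C * D * (2 * (1 + y ^ 2)⁻¹) :=
          mul_le_mul_of_nonneg_left (inv_one_add_sq_mul_le x y) (mul_nonneg hC0 hD0)
      _ = C * D * 2 * (1 + y ^ 2)⁻¹ := (mul_assoc _ _ _).symm

lemma norm_le_inv_one_add_sq {φ : ℝ → ℂ} {A B : ℝ} (hA : ∀ x, ‖φ x‖ ≤ A)
    (hB : ∀ x, |x| ^ 2 * ‖φ x‖ ≤ B) (x : ℝ) : ‖φ x‖ ≤ (A + B) * (1 + x ^ 2)⁻¹ := by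
  rw [← div_eq_mul_inv, le_div_iff₀ (by positivity), ← sq_abs]
  linarith [hA x, hB x]

lemma exists_norm_le_inv_one_add_sq (φ : 𝓢(ℝ, ℂ)) : ∃ C, ∀ x, ‖φ x‖ ≤ C * (1 + x ^ 2)⁻¹ := by
  obtain ⟨A, -, hA⟩ := φ.decay 0 0
  obtain ⟨B, -, hB⟩ := φ.decay 2 0
  simp only [pow_zero, one_mul, norm_iteratedFDeriv_zero, Real.norm_eq_abs] at hA hB
  exact ⟨A + B, norm_le_inv_one_add_sq hA hB⟩

lemma quadDecay_crossDensity (φ ψ : 𝓢(ℝ, ℂ)) : QuadDecay (crossDensity φ ψ) := by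
  obtain ⟨C, hC⟩ := exists_norm_le_inv_one_add_sq φ
  obtain ⟨D, hD⟩ := exists_norm_le_inv_one_add_sq ψ
  exact quadDecay_crossDensity_of_bound φ.continuous ψ.continuous hC hD

/-- The derivative of a cross density in the mean position. -/
def crossDx (φ ψ : 𝓢(ℝ, ℂ)) (x y : ℝ) : ℂ :=
  crossDensity (sderiv φ) ψ x y + crossDensity φ (sderiv ψ) x y

/-- The derivative of a cross density in the relative position. -/
def crossDy (φ ψ : 𝓢(ℝ, ℂ)) (x y : ℝ) : ℂ :=
  (1 / 2) * (crossDensity φ (sderiv ψ) x y - crossDensity (sderiv φ) ψ x y)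

lemma quadDecay_crossDx (φ ψ : 𝓢(ℝ, ℂ)) : QuadDecay (crossDx φ ψ) :=
  (quadDecay_crossDensity _ _).add (quadDecay_crossDensity _ _)

lemma quadDecay_crossDy (φ ψ : 𝓢(ℝ, ℂ)) : QuadDecay (crossDy φ ψ) :=
  ((quadDecay_crossDensity _ _).sub (quadDecay_crossDensity _ _)).const_mul _

lemma hasDerivAt_crossDensity_fst (φ ψ : 𝓢(ℝ, ℂ)) (x y : ℝ) :
    HasDerivAt (fun x => crossDensity φ ψ x y) (crossDx φ ψ x y) x :=
  ((hasDerivAt_sderiv φ (x - y / 2)).comp_sub_const x (y / 2)).star.mul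
    ((hasDerivAt_sderiv ψ (x + y / 2)).comp_add_const x (y / 2))

lemma hasDerivAt_crossDensity_snd (φ ψ : 𝓢(ℝ, ℂ)) (x y : ℝ) :
    HasDerivAt (crossDensity φ ψ x) (crossDy φ ψ x y) y := by
  have hminus : HasDerivAt (fun y : ℝ => x - y / 2) (-(1 / 2)) y :=
    ((hasDerivAt_id y).div_const 2).const_sub x
  have hplus : HasDerivAt (fun y : ℝ => x + y / 2) (1 / 2) y :=
    ((hasDerivAt_id y).div_const 2).const_add x
  refine (((hasDerivAt_sderiv φ (x - y / 2)).scomp y hminus).star.mul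
    ((hasDerivAt_sderiv ψ (x + y / 2)).scomp y hplus)).congr_deriv ?_
  simp only [crossDy, crossDensity, Function.comp, Complex.real_smul, star_mul',
    RCLike.star_def, Complex.conj_ofReal]
  push_cast
  ring

end CrossDensity

section CrossWigner

variable {hbar : ℝ}

/-- The Wigner transform of a pair of wave functions. -/
def crossWigner (hbar : ℝ) (φ ψ : 𝓢(ℝ, ℂ)) : ℝ → ℝ → ℂ :=
  partialFourier hbar (crossDensity φ ψ)

lemma continuous_crossWigner (φ ψ : 𝓢(ℝ, ℂ)) :
    Continuous (Function.uncurry (crossWigner hbar φ ψ)) :=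
  (quadDecay_crossDensity φ ψ).continuous_partialFourier

lemma partialFourier_crossDx (φ ψ : 𝓢(ℝ, ℂ)) (p x : ℝ) :
    partialFourier hbar (crossDx φ ψ) p x =
      crossWigner hbar (sderiv φ) ψ p x + crossWigner hbar φ (sderiv ψ) p x :=
  (quadDecay_crossDensity _ _).partialFourier_add (quadDecay_crossDensity _ _) p x

lemma partialFourier_crossDy (φ ψ : 𝓢(ℝ, ℂ)) (p x : ℝ) :
    partialFourier hbar (crossDy φ ψ) p x =
      (1 / 2) * (crossWigner hbar φ (sderiv ψ) p x - crossWigner hbar (sderiv φ) ψ p x) := by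
  unfold crossDy
  rw [partialFourier_const_mul,
    (quadDecay_crossDensity _ _).partialFourier_sub (quadDecay_crossDensity _ _)]
  rfl

lemma momentum_mul_crossWigner (hb : hbar ≠ 0) (φ ψ : 𝓢(ℝ, ℂ)) (p x : ℝ) :
    (p : ℂ) * crossWigner hbar φ ψ p x = -Complex.I * hbar / 2 *
      (crossWigner hbar φ (sderiv ψ) p x - crossWigner hbar (sderiv φ) ψ p x) := by
  rw [crossWigner, (quadDecay_crossDensity φ ψ).momentum_mul_partialFourier hb
    (quadDecay_crossDy φ ψ) (hasDerivAt_crossDensity_snd φ ψ), partialFourier_crossDy]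
  ring

lemma abs_momentum_mul_norm_crossWigner_le (hb : hbar ≠ 0) (φ ψ : 𝓢(ℝ, ℂ)) (p x : ℝ) :
    |p| * ‖crossWigner hbar φ ψ p x‖ ≤ |hbar| / 2 *
      (‖crossWigner hbar φ (sderiv ψ) p x‖ + ‖crossWigner hbar (sderiv φ) ψ p x‖) := by
  have h := congrArg norm (momentum_mul_crossWigner hb φ ψ p x)
  simp only [norm_mul, norm_div, norm_neg, Complex.norm_I, one_mul, Complex.norm_real,
    Real.norm_eq_abs, Complex.norm_ofNat] at h
  rw [h]
  gcongr
  exact norm_sub_le _ _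

lemma exists_pow_mul_norm_crossWigner_le (hb : hbar ≠ 0) (j : ℕ) (φ ψ : 𝓢(ℝ, ℂ)) :
    ∃ C, ∀ p x, |p| ^ j * ‖crossWigner hbar φ ψ p x‖ ≤ C := by
  induction j generalizing φ ψ with
  | zero =>
    simpa only [pow_zero, one_mul, crossWigner] using
      (quadDecay_crossDensity φ ψ).norm_partialFourier_le
  | succ j ih =>
    obtain ⟨C, hC⟩ := ih φ (sderiv ψ)
    obtain ⟨D, hD⟩ := ih (sderiv φ) ψ
    refine ⟨|hbar| / 2 * (C + D), fun p x => ?_⟩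
    calc |p| ^ (j + 1) * ‖crossWigner hbar φ ψ p x‖
        = |p| ^ j * (|p| * ‖crossWigner hbar φ ψ p x‖) := by rw [pow_succ, mul_assoc]
      _ ≤ |p| ^ j * (|hbar| / 2 *
          (‖crossWigner hbar φ (sderiv ψ) p x‖ + ‖crossWigner hbar (sderiv φ) ψ p x‖)) :=
          mul_le_mul_of_nonneg_left (abs_momentum_mul_norm_crossWigner_le hb φ ψ p x)
            (by positivity)
      _ = |hbar| / 2 * (|p| ^ j * ‖crossWigner hbar φ (sderiv ψ) p x‖ +
          |p| ^ j * ‖crossWigner hbar (sderiv φ) ψ p x‖) := by ring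
      _ ≤ |hbar| / 2 * (C + D) := by
          gcongr
          exacts [hC p x, hD p x]

lemma rapidDecay_re_crossWigner (hb : hbar ≠ 0) (φ ψ : 𝓢(ℝ, ℂ)) :
    RapidDecay (fun p x => (crossWigner hbar φ ψ p x).re) where
  continuous := Complex.continuous_re.comp (continuous_crossWigner φ ψ)
  bound j := by
    obtain ⟨C, hC⟩ := exists_pow_mul_norm_crossWigner_le hb j φ ψ
    exact ⟨C, fun p x => le_trans (by gcongr; exact Complex.abs_re_le_norm _) (hC p x)⟩

lemma integrable_crossWigner (hb : hbar ≠ 0) (φ ψ : 𝓢(ℝ, ℂ)) (x : ℝ) :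
    Integrable (fun p => crossWigner hbar φ ψ p x) := by
  obtain ⟨C, hC⟩ := exists_pow_mul_norm_crossWigner_le hb 0 φ ψ
  obtain ⟨D, hD⟩ := exists_pow_mul_norm_crossWigner_le hb 2 φ ψ
  simp only [pow_zero, one_mul] at hC
  exact (integrable_inv_one_add_sq.const_mul (C + D)).mono'
    ((continuous_crossWigner φ ψ).uncurry_right x).aestronglyMeasurable
    (ae_of_all _ (norm_le_inv_one_add_sq (hC · x) (hD · x)))

lemma integral_crossWigner_mul_phaseFactor (hb : 0 < hbar) (φ ψ : 𝓢(ℝ, ℂ)) (x y : ℝ) :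
    ∫ p, crossWigner hbar φ ψ p x * phaseFactor (-(p * y / hbar)) = crossDensity φ ψ x y :=
  (quadDecay_crossDensity φ ψ).integral_partialFourier_mul_phaseFactor hb
    (integrable_crossWigner hb.ne' φ ψ x) y

lemma integral_crossWigner (hb : 0 < hbar) (φ ψ : 𝓢(ℝ, ℂ)) (x : ℝ) :
    ∫ p, crossWigner hbar φ ψ p x = starRingEnd ℂ (φ x) * ψ x := by
  simpa [crossDensity, phaseFactor_zero] using integral_crossWigner_mul_phaseFactor hb φ ψ x 0

lemma conj_crossWigner (φ ψ : 𝓢(ℝ, ℂ)) (p x : ℝ) :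
    starRingEnd ℂ (crossWigner hbar φ ψ p x) = crossWigner hbar ψ φ p x := by
  rw [crossWigner, crossWigner, partialFourier, partialFourier, map_mul, Complex.conj_ofReal,
    ← integral_conj, ← integral_neg_eq_self]
  congr 2 with y
  rw [map_mul, conj_phaseFactor, crossDensity, crossDensity, map_mul, Complex.conj_conj,
    mul_neg, neg_div, neg_div, neg_neg, sub_neg_eq_add, ← sub_eq_add_neg, mul_comm (φ _)]

end CrossWigner

section Wigner

variable {hbar : ℝ}

lemma wigner_eq_re (hbar : ℝ) (ψ : 𝓢(ℝ, ℂ)) :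
    wigner hbar ψ = fun p x => (crossWigner hbar ψ ψ p x).re := by
  ext p x
  rw [crossWigner, partialFourier, Complex.re_ofReal_mul]
  rfl

lemma ofReal_wigner (ψ : 𝓢(ℝ, ℂ)) (p x : ℝ) :
    (wigner hbar ψ p x : ℂ) = crossWigner hbar ψ ψ p x := by
  rw [wigner_eq_re]
  exact Complex.conj_eq_iff_re.1 (conj_crossWigner ψ ψ p x)

/-- The position derivative of the Wigner function. -/
def wignerDx (hbar : ℝ) (ψ : 𝓢(ℝ, ℂ)) (p x : ℝ) : ℝ :=
  (crossWigner hbar (sderiv ψ) ψ p x).re + (crossWigner hbar ψ (sderiv ψ) p x).re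

lemma rapidDecay_wigner (hb : hbar ≠ 0) (ψ : 𝓢(ℝ, ℂ)) : RapidDecay (wigner hbar ψ) := by
  rw [wigner_eq_re]
  exact rapidDecay_re_crossWigner hb ψ ψ

lemma rapidDecay_wignerDx (hb : hbar ≠ 0) (ψ : 𝓢(ℝ, ℂ)) : RapidDecay (wignerDx hbar ψ) :=
  (rapidDecay_re_crossWigner hb _ _).add (rapidDecay_re_crossWigner hb _ _)

lemma hasDerivAt_wigner (ψ : 𝓢(ℝ, ℂ)) (p x : ℝ) :
    HasDerivAt (wigner hbar ψ p) (wignerDx hbar ψ p x) x := by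
  have h := (quadDecay_crossDensity ψ ψ).hasDerivAt_partialFourier (hbar := hbar)
    (quadDecay_crossDx ψ ψ) (hasDerivAt_crossDensity_fst ψ ψ) p x
  rw [partialFourier_crossDx] at h
  rw [wigner_eq_re]
  exact Complex.reCLM.hasFDerivAt.comp_hasDerivAt x h

end Wigner

section SincProduct

variable {hbar : ℝ}

/-- A cross density as a Schwartz function of the mean position. -/
def crossDensitySlice (φ ψ : 𝓢(ℝ, ℂ)) (y : ℝ) : 𝓢(ℝ, ℂ) :=
  pairing (ContinuousLinearMap.mul ℝ ℂ)
    (postcompCLM (𝕜 := ℝ) Complex.conjCLE.toContinuousLinearMap (φ.compSubConstCLM ℝ (y / 2)))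
    (ψ.compSubConstCLM ℝ (-(y / 2)))

lemma crossDensitySlice_apply (φ ψ : 𝓢(ℝ, ℂ)) (x y : ℝ) :
    crossDensitySlice φ ψ y x = crossDensity φ ψ x y := by
  simp [crossDensitySlice, crossDensity]

lemma phaseFourier_wigner (hb : 0 < hbar) (ψ : 𝓢(ℝ, ℂ)) (ξ η : ℝ) :
    phaseFourier (wigner hbar ψ) ξ η =
      𝓕 (crossDensitySlice ψ ψ (-hbar * ξ) : ℝ → ℂ) (η / (2 * π * 1)) := by
  rw [phaseFourier, ← integral_mul_phaseFactor]
  congr 1 with x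
  rw [crossDensitySlice_apply, ← integral_crossWigner_mul_phaseFactor hb, ← integral_mul_const]
  congr 1 with p
  rw [ofReal_wigner, mul_assoc, ← phaseFactor_add, phaseFactor, div_one,
    show -(p * (-hbar * ξ) / hbar) = ξ * p by field_simp]

lemma integral_phaseFourier_wigner (hb : 0 < hbar) (ψ : 𝓢(ℝ, ℂ)) (ξ p x : ℝ) :
    ∫ η, phaseFourier (wigner hbar ψ) ξ η *
        Complex.exp (Complex.I * ((ξ * p + η * x : ℝ) : ℂ)) =
      ((2 * π : ℝ) : ℂ) * (crossDensity ψ ψ x (-hbar * ξ) *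
        phaseFactor (p * (-hbar * ξ) / hbar)) := by
  have hphase (η : ℝ) : Complex.exp (Complex.I * ((ξ * p + η * x : ℝ) : ℂ)) =
      phaseFactor (-(η * x / 1)) * phaseFactor (p * (-hbar * ξ) / hbar) := by
    rw [← phaseFactor_neg, ← phaseFactor_add]
    congr 1
    field_simp
    ring
  have hinv := integral_fourier_mul_phaseFactor (crossDensitySlice ψ ψ (-hbar * ξ)).integrable
    (𝓕 (crossDensitySlice ψ ψ (-hbar * ξ))).integrable
    (crossDensitySlice ψ ψ (-hbar * ξ)).continuous one_pos x
  simp only [phaseFourier_wigner hb, hphase, ← mul_assoc, integral_mul_const]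
  rw [hinv, crossDensitySlice_apply, mul_one]

/-- For right factors whose averaged translates do not depend on the frequency of position, the
sinc product multiplies the off-diagonal density by those averages. -/
lemma sincProduct_wigner (hb : 0 < hbar) (ψ : 𝓢(ℝ, ℂ)) (b : ℝ → ℝ → ℝ) (w : ℝ → ℝ)
    (p x : ℝ) (hw : ∀ ξ η : ℝ, (1 / 2) * ∫ s in (-1 : ℝ)..1,
      b (p - s * hbar * η / 2) (x + s * hbar * ξ / 2) = w (-hbar * ξ)) :
    sincProduct hbar (wigner hbar ψ) b p x =
      (partialFourier hbar (fun x y => crossDensity ψ ψ x y * w y) p x).re := by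
  have hη (ξ : ℝ) : ∫ η, phaseFourier (wigner hbar ψ) ξ η *
      Complex.exp (Complex.I * ((ξ * p + η * x : ℝ) : ℂ)) * (w (-hbar * ξ) : ℂ) =
      ((2 * π : ℝ) : ℂ) * (crossDensity ψ ψ x (-hbar * ξ) * w (-hbar * ξ) *
        phaseFactor (p * (-hbar * ξ) / hbar)) := by
    rw [integral_mul_const, integral_phaseFourier_wigner hb]
    ring
  unfold sincProduct
  simp only [hw, hη]
  rw [integral_const_mul, Measure.integral_comp_mul_left (fun y => crossDensity ψ ψ x y *
      (w y : ℂ) * phaseFactor (p * y / hbar)) (-hbar), partialFourier, Complex.re_ofReal_mul,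
    Complex.re_ofReal_mul, Complex.real_smul, Complex.re_ofReal_mul, inv_neg, abs_neg,
    abs_of_pos (inv_pos.2 hb)]
  field_simp

end SincProduct

section Growth

/-- At most polynomial growth, without any condition on derivatives. -/
def PolyGrowth (f : ℝ → ℝ) : Prop :=
  ∃ (C : ℝ) (k : ℕ), ∀ x : ℝ, |f x| ≤ C * (1 + |x|) ^ k

lemma exists_one_add_abs_pow_mul_norm_le (k : ℕ) (ψ : 𝓢(ℝ, ℂ)) :
    ∃ D, ∀ x : ℝ, (1 + |x|) ^ k * ‖ψ x‖ ≤ D * (1 + x ^ 2)⁻¹ := by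
  refine ⟨2 ^ (k + 2) * (Finset.Iic (k + 2, 0)).sup (fun i => SchwartzMap.seminorm ℝ i.1 i.2) ψ,
    fun x => ?_⟩
  have hsup := one_add_le_sup_seminorm_apply (𝕜 := ℝ) (m := (k + 2, 0)) (k := k + 2) (n := 0)
    le_rfl le_rfl ψ x
  rw [norm_iteratedFDeriv_zero, Real.norm_eq_abs] at hsup
  have hsq : 1 + x ^ 2 ≤ (1 + |x|) ^ 2 := by
    rw [← sq_abs]
    nlinarith [abs_nonneg x]
  rw [← div_eq_mul_inv, le_div_iff₀ (by positivity)]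
  calc (1 + |x|) ^ k * ‖ψ x‖ * (1 + x ^ 2)
      ≤ (1 + |x|) ^ k * ‖ψ x‖ * (1 + |x|) ^ 2 := by gcongr
    _ = (1 + |x|) ^ (k + 2) * ‖ψ x‖ := by ring
    _ ≤ _ := hsup

lemma quadDecay_crossDensity_mul {W : ℝ → ℝ → ℝ} (hW : Continuous (Function.uncurry W)) {C : ℝ}
    {k : ℕ} (hC : ∀ x y, |W x y| ≤ C * ((1 + |x - y / 2|) ^ k * (1 + |x + y / 2|) ^ k))
    (φ ψ : 𝓢(ℝ, ℂ)) : QuadDecay (fun x y => crossDensity φ ψ x y * W x y) where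
  continuous := (continuous_crossDensity φ.continuous ψ.continuous).mul
    (Complex.continuous_ofReal.comp hW)
  bound := by
    have hC0 : 0 ≤ C := by simpa using (abs_nonneg _).trans (hC 0 0)
    have hnorm (χ : 𝓢(ℝ, ℂ)) (x : ℝ) :
        ‖(((1 + |x|) ^ k : ℝ) : ℂ) * χ x‖ = (1 + |x|) ^ k * ‖χ x‖ := by
      rw [norm_mul, Complex.norm_real, Real.norm_eq_abs, abs_of_nonneg (by positivity)]
    obtain ⟨D, hD⟩ := exists_one_add_abs_pow_mul_norm_le k φ
    obtain ⟨E, hE⟩ := exists_one_add_abs_pow_mul_norm_le k ψ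
    obtain ⟨B, hB⟩ := (quadDecay_crossDensity_of_bound
      (φ := fun x => (((1 + |x|) ^ k : ℝ) : ℂ) * φ x)
      (ψ := fun x => (((1 + |x|) ^ k : ℝ) : ℂ) * ψ x) (by fun_prop) (by fun_prop)
      (fun x => (hnorm φ x).le.trans (hD x)) (fun x => (hnorm ψ x).le.trans (hE x))).bound
    refine ⟨C * B, fun x y => ?_⟩
    have hxy := hB x y
    rw [crossDensity, norm_mul, RCLike.norm_conj, hnorm, hnorm] at hxy
    rw [norm_mul, crossDensity, norm_mul, RCLike.norm_conj, Complex.norm_real, Real.norm_eq_abs]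
    calc ‖φ (x - y / 2)‖ * ‖ψ (x + y / 2)‖ * |W x y|
        ≤ ‖φ (x - y / 2)‖ * ‖ψ (x + y / 2)‖ *
          (C * ((1 + |x - y / 2|) ^ k * (1 + |x + y / 2|) ^ k)) := by gcongr; exact hC x y
      _ = C * ((1 + |x - y / 2|) ^ k * ‖φ (x - y / 2)‖ *
          ((1 + |x + y / 2|) ^ k * ‖ψ (x + y / 2)‖)) := by ring
      _ ≤ C * (B * (1 + y ^ 2)⁻¹) := mul_le_mul_of_nonneg_left hxy hC0
      _ = C * B * (1 + y ^ 2)⁻¹ := (mul_assoc _ _ _).symm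

lemma abs_segment_le (x y : ℝ) {s : ℝ} (hs : s ∈ Icc (-1) 1) :
    |x + s * (y / 2)| ≤ |x - y / 2| + |x + y / 2| := by
  rw [show x + s * (y / 2) = (1 - s) / 2 * (x - y / 2) + (1 + s) / 2 * (x + y / 2) by ring]
  refine (abs_add_le _ _).trans (add_le_add ?_ ?_)
  · rw [abs_mul, abs_of_nonneg (by linarith [hs.2])]
    exact mul_le_of_le_one_left (abs_nonneg _) (by linarith [hs.1])
  · rw [abs_mul, abs_of_nonneg (by linarith [hs.1])]
    exact mul_le_of_le_one_left (abs_nonneg _) (by linarith [hs.2])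

end Growth

section WignerFlow

variable {hbar m : ℝ} {V : ℝ → ℝ}

lemma deriv_weylHamiltonian_momentum (hm : m ≠ 0) (p x : ℝ) :
    deriv (fun z => weylHamiltonian m V z x) p = p / m := by
  have h : HasDerivAt (fun z => weylHamiltonian m V z x) (2 * p / (2 * m)) p := by
    simpa [weylHamiltonian] using (((hasDerivAt_id p).pow 2).div_const (2 * m)).add_const (V x)
  rw [h.deriv]
  field_simp

lemma deriv_weylHamiltonian_position (p x : ℝ) :
    deriv (fun z => weylHamiltonian m V p z) x = deriv V x := by
  unfold weylHamiltonian
  rw [deriv_const_add]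

lemma half_integral_sub_mul (a b : ℝ) : (1 / 2) * ∫ s in (-1 : ℝ)..1, (a - s * b) = a := by
  rw [intervalIntegral.integral_sub (Continuous.intervalIntegrable (by fun_prop) _ _)
    (Continuous.intervalIntegrable (by fun_prop) _ _), intervalIntegral.integral_mul_const,
    integral_id, intervalIntegral.integral_const, smul_eq_mul]
  ring

lemma wignerFlowX_eq (hb : 0 < hbar) (hm : m ≠ 0) (ψ : 𝓢(ℝ, ℂ)) (p x : ℝ) :
    wignerFlowX hbar m V ψ p x = 1 / m * (p * wigner hbar ψ p x) := by
  have hmean (_ η : ℝ) : (1 / 2) * ∫ s in (-1 : ℝ)..1, (p - s * hbar * η / 2) / m = p / m := by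
    rw [← half_integral_sub_mul (p / m) (hbar * η / 2 / m)]
    congr 2 with s
    ring
  unfold wignerFlowX
  simp only [deriv_weylHamiltonian_momentum hm]
  rw [sincProduct_wigner hb ψ _ (fun _ => p / m) p x hmean]
  simp only [mul_comm (crossDensity ψ ψ _ _)]
  rw [partialFourier_const_mul, Complex.re_ofReal_mul, wigner_eq_re,
    ← mul_assoc, one_div_mul_eq_div]
  rfl

/-- The symmetric mean of `V'` over the segment between `x - y / 2` and `x + y / 2`: the factor by
which the sinc product with `V'` multiplies the off-diagonal density. -/
def forceMean (V : ℝ → ℝ) (x y : ℝ) : ℝ :=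
  (1 / 2) * ∫ s in (-1 : ℝ)..1, deriv V (x + s * (y / 2))

lemma wignerFlowP_eq (hb : 0 < hbar) (ψ : 𝓢(ℝ, ℂ)) (p x : ℝ) :
    wignerFlowP hbar m V ψ p x =
      -(partialFourier hbar (fun x y => crossDensity ψ ψ x y * forceMean V x y) p x).re := by
  have hmean (ξ _ : ℝ) : (1 / 2) * ∫ s in (-1 : ℝ)..1, deriv V (x + s * hbar * ξ / 2) =
      forceMean V x (-hbar * ξ) := by
    have hneg := intervalIntegral.integral_comp_neg (a := -1) (b := 1)
      (fun s => deriv V (x + s * hbar * ξ / 2))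
    rw [neg_neg] at hneg
    rw [← hneg, forceMean]
    congr 2 with s
    ring_nf
  unfold wignerFlowP
  simp only [deriv_weylHamiltonian_position]
  rw [sincProduct_wigner hb ψ _ (forceMean V x) p x hmean]
  simp only [partialFourier]

lemma continuous_forceMean (hV : ContDiff ℝ 1 V) : Continuous (Function.uncurry (forceMean V)) := by
  have hV' : Continuous (deriv V) := hV.continuous_deriv le_rfl
  refine continuous_const.mul
    (intervalIntegral.continuous_parametric_intervalIntegral_of_continuous' ?_ (-1) 1)
  exact hV'.comp (by fun_prop)

lemma forceMean_zero (x : ℝ) : forceMean V x 0 = deriv V x := by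
  simp only [forceMean, zero_div, mul_zero, add_zero, intervalIntegral.integral_const, smul_eq_mul]
  ring

lemma mul_forceMean (hV : ContDiff ℝ 1 V) (x y : ℝ) :
    y * forceMean V x y = V (x + y / 2) - V (x - y / 2) := by
  have hd (s : ℝ) : HasDerivAt (fun s => V (x + s * (y / 2)))
      (deriv V (x + s * (y / 2)) * (y / 2)) s :=
    ((hV.differentiable one_ne_zero _).hasDerivAt).comp s
      (by simpa using ((hasDerivAt_id s).mul_const (y / 2)).const_add x)
  have hftc := intervalIntegral.integral_eq_sub_of_hasDerivAt (a := -1) (b := 1)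
    (fun s _ => hd s)
    ((((hV.continuous_deriv le_rfl).comp (by fun_prop)).mul_const _).intervalIntegrable _ _)
  rw [intervalIntegral.integral_mul_const, one_mul, neg_one_mul, ← sub_eq_add_neg] at hftc
  rw [forceMean, ← hftc]
  ring

lemma abs_forceMean_le {C : ℝ} {k : ℕ} (hC : ∀ x, |deriv V x| ≤ C * (1 + |x|) ^ k) (x y : ℝ) :
    |forceMean V x y| ≤ C * ((1 + |x - y / 2|) ^ k * (1 + |x + y / 2|) ^ k) := by
  have hC0 : 0 ≤ C := by simpa using (abs_nonneg _).trans (hC 0)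
  have hbound : ∀ s ∈ uIoc (-1 : ℝ) 1, ‖deriv V (x + s * (y / 2))‖ ≤
      C * ((1 + |x - y / 2|) ^ k * (1 + |x + y / 2|) ^ k) := by
    intro s hs
    rw [uIoc_of_le (by norm_num)] at hs
    have hsum : 1 + |x + s * (y / 2)| ≤ (1 + |x - y / 2|) * (1 + |x + y / 2|) := by
      nlinarith [abs_segment_le x y (Ioc_subset_Icc_self hs),
        mul_nonneg (abs_nonneg (x - y / 2)) (abs_nonneg (x + y / 2))]
    rw [← mul_pow]
    exact (hC _).trans (by gcongr)
  have h := intervalIntegral.norm_integral_le_of_norm_le_const hbound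
  rw [Real.norm_eq_abs] at h
  rw [forceMean, abs_mul]
  norm_num at h ⊢
  linarith

lemma quadDecay_crossDensity_mul_forceMean (hV : ContDiff ℝ 1 V) (hVg : PolyGrowth (deriv V))
    (φ ψ : 𝓢(ℝ, ℂ)) : QuadDecay (fun x y => crossDensity φ ψ x y * forceMean V x y) := by
  obtain ⟨C, k, hC⟩ := hVg
  exact quadDecay_crossDensity_mul (continuous_forceMean hV) (abs_forceMean_le hC) φ ψ

end WignerFlow

section GaussSampling

variable {hbar σ : ℝ} {F G : ℝ → ℝ → ℂ}

lemma hasDerivAt_phaseFactor (θ : ℝ) :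
    HasDerivAt phaseFactor (-Complex.I * phaseFactor θ) θ := by
  refine (((hasDerivAt_id θ).ofReal_comp.const_mul (-Complex.I)).cexp).congr_deriv ?_
  rw [Complex.ofReal_one, mul_one, mul_comm]
  rfl

lemma QuadDecay.norm_le (hF : QuadDecay F) : ∃ C, ∀ x y, ‖F x y‖ ≤ C := by
  obtain ⟨C, hC⟩ := hF.bound
  have hC0 : 0 ≤ C := by simpa using (norm_nonneg _).trans (hC 0 0)
  exact ⟨C, fun x y => (hC x y).trans (mul_le_of_le_one_right hC0
    (inv_le_one_of_one_le₀ (le_add_of_nonneg_right (sq_nonneg y))))⟩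

/-- The average of `F(x - σ z₂, τ z₁) exp(-i p z₁)` over two independent standard Gaussians. With
`τ = ℏ / σp` it is the Gaussian smoothing of the partial Fourier transform of `F`, freed of the
factor `1 / σp` that vanishes in the Bohmian limit. -/
def gaussSampling (F : ℝ → ℝ → ℂ) (σ τ p x : ℝ) : ℂ :=
  ∫ z : ℝ × ℝ, F (x - σ * z.2) (τ * z.1) * phaseFactor (p * z.1) ∂(stdGauss.prod stdGauss)

lemma QuadDecay.integrable_sampling (hF : QuadDecay F) (σ τ p x : ℝ) :
    Integrable (fun z : ℝ × ℝ => F (x - σ * z.2) (τ * z.1) * phaseFactor (p * z.1))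
      (stdGauss.prod stdGauss) := by
  obtain ⟨C, hC⟩ := hF.norm_le
  have hcont : Continuous fun z : ℝ × ℝ => F (x - σ * z.2) (τ * z.1) :=
    hF.continuous.comp (by fun_prop : Continuous fun z : ℝ × ℝ => (x - σ * z.2, τ * z.1))
  refine (integrable_const C).mono' (hcont.mul (by fun_prop)).aestronglyMeasurable
    (ae_of_all _ fun z => ?_)
  rw [norm_mul, norm_phaseFactor, mul_one]
  exact hC _ _

lemma integral_phaseFactor_stdGauss (θ : ℝ) :
    ∫ z, phaseFactor (θ * z) ∂stdGauss = (Real.exp (-(θ ^ 2 / 2)) : ℂ) := by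
  have h := charFun_gaussianReal (μ := 0) (v := 1) (-θ)
  rw [charFun_apply_real] at h
  convert h using 1
  · congr 1 with z
    rw [phaseFactor]
    congr 1
    push_cast
    ring
  · rw [Complex.ofReal_exp]
    congr 1
    push_cast
    simp

lemma integral_gaussDensity_mul_phaseFactor (hσ : σ ≠ 0) (hb : hbar ≠ 0) (p y : ℝ) :
    ∫ q, (gaussDensity σ (p - q) : ℂ) * phaseFactor (q * y / hbar) =
      gaussWeight (hbar / σ) y * phaseFactor (p * y / hbar) := by
  have hshift (u : ℝ) : (gaussDensity σ (p - (p - u)) : ℂ) * phaseFactor ((p - u) * y / hbar) =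
      phaseFactor (p * y / hbar) * (gaussDensity σ u • phaseFactor (-(y / hbar) * u)) := by
    rw [sub_sub_cancel, Complex.real_smul, mul_left_comm, ← phaseFactor_add]
    ring_nf
  rw [← integral_sub_left_eq_self _ volume p]
  simp only [hshift]
  rw [integral_const_mul, integral_gaussDensity_smul hσ, mul_comm]
  simp only [← mul_assoc]
  rw [integral_phaseFactor_stdGauss, gaussWeight]
  congr 4
  field_simp

lemma integral_mul_gaussWeight {τ : ℝ} (hτ : 0 < τ) (f : ℝ → ℂ) :
    ∫ y, f y * gaussWeight τ y = ((√(2 * π) * τ : ℝ) : ℂ) * ∫ z, f (τ * z) ∂stdGauss := by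
  have hpos : 0 < √(2 * π) * τ := by positivity
  rw [← integral_gaussDensity_smul hτ.ne', ← integral_const_mul]
  congr 1 with y
  rw [gaussDensity_eq hτ, Complex.real_smul, ← mul_assoc, ← Complex.ofReal_mul,
    mul_inv_cancel_left₀ hpos.ne', mul_comm]

lemma QuadDecay.integrable_gaussDensity_mul_partialFourier (hF : QuadDecay F) (σ p x : ℝ) :
    Integrable (fun q => (gaussDensity σ (p - q) : ℂ) * partialFourier hbar F q x) := by
  obtain ⟨C, hC⟩ := hF.norm_partialFourier_le (hbar := hbar)
  exact ((integrable_gaussDensity σ).comp_sub_left p).ofReal.mul_bdd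
    (hF.continuous_partialFourier.uncurry_right x).aestronglyMeasurable
    (ae_of_all _ fun q => hC q x)

lemma integral_gaussDensity_mul_partialFourier_swap (hσ : σ ≠ 0) (hb : hbar ≠ 0)
    (hF : QuadDecay F) (p x : ℝ) :
    ∫ q, (gaussDensity σ (p - q) : ℂ) * partialFourier hbar F q x =
      ((1 / (2 * π * hbar) : ℝ) : ℂ) *
        ∫ y, F x y * phaseFactor (p * y / hbar) * gaussWeight (hbar / σ) y := by
  have hint : Integrable (Function.uncurry fun (q y : ℝ) =>
      (gaussDensity σ (p - q) : ℂ) * (F x y * phaseFactor (q * y / hbar)))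
      (volume.prod volume) := by
    have hdensity := ((integrable_gaussDensity σ).comp_sub_left p).ofReal (𝕜 := ℂ)
    refine ((hdensity.mul_prod (hF.integrable x)).mul_bdd (c := 1)
      (g := fun z : ℝ × ℝ => phaseFactor (z.1 * z.2 / hbar)) (by fun_prop)
      (ae_of_all _ fun _ => (norm_phaseFactor _).le)).congr (ae_of_all _ fun z => ?_)
    exact mul_assoc _ _ _
  simp only [partialFourier, mul_left_comm _ ((1 / (2 * π * hbar) : ℝ) : ℂ), integral_const_mul]
  simp only [← integral_const_mul (gaussDensity σ _ : ℂ)]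
  rw [integral_integral_swap hint]
  congr 2 with y
  simp only [mul_left_comm _ (F x y), integral_const_mul]
  rw [integral_gaussDensity_mul_phaseFactor hσ hb, mul_comm (gaussWeight _ _ : ℂ), mul_assoc]

lemma integral_gaussDensity_mul_partialFourier (hσ : 0 < σ) (hb : 0 < hbar) (hF : QuadDecay F)
    (p x : ℝ) :
    ∫ q, (gaussDensity σ (p - q) : ℂ) * partialFourier hbar F q x =
      (((√(2 * π) * σ)⁻¹ : ℝ) : ℂ) *
        ∫ z, F x (hbar / σ * z) * phaseFactor (p / σ * z) ∂stdGauss := by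
  have hphase (z : ℝ) : p * (hbar / σ * z) / hbar = p / σ * z := by field_simp
  have hconst : 1 / (2 * π * hbar) * (√(2 * π) * (hbar / σ)) = (√(2 * π) * σ)⁻¹ := by
    refine eq_inv_of_mul_eq_one_left ?_
    field_simp
    exact Real.sq_sqrt (by positivity)
  rw [integral_gaussDensity_mul_partialFourier_swap hσ.ne' hb.ne' hF,
    integral_mul_gaussWeight (div_pos hb hσ), ← mul_assoc, ← Complex.ofReal_mul, hconst]
  simp only [hphase]

lemma smooth_re_partialFourier {σp σx : ℝ} (hp : 0 < σp) (hx : 0 < σx) (hb : 0 < hbar)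
    (hF : QuadDecay F) (p x : ℝ) :
    smooth σp σx (fun p x => (partialFourier hbar F p x).re) p x =
      (√(2 * π) * σp)⁻¹ * (gaussSampling F σx (hbar / σp) (p / σp) x).re := by
  have hint := hF.integrable_sampling σx (hbar / σp) (p / σp) x
  have hmom (x' : ℝ) : ∫ q, (partialFourier hbar F q x').re * gaussDensity σp (p - q) =
      (√(2 * π) * σp)⁻¹ *
        (∫ z, F x' (hbar / σp * z) * phaseFactor (p / σp * z) ∂stdGauss).re := by
    rw [← Complex.re_ofReal_mul, ← integral_gaussDensity_mul_partialFourier hp hb hF]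
    refine Eq.trans ?_ (integral_re (hF.integrable_gaussDensity_mul_partialFourier σp p x'))
    congr 1 with q
    exact (mul_comm _ _).trans (Complex.re_ofReal_mul _ _).symm
  unfold smooth
  simp only [husimiKernel_eq hp hx, ← mul_assoc, integral_mul_const, hmom]
  rw [← integral_sub_left_eq_self _ volume x]
  simp only [sub_sub_cancel, mul_comm _ (gaussDensity σx _), ← smul_eq_mul (gaussDensity σx _)]
  rw [integral_gaussDensity_smul hx.ne' fun u => (√(2 * π) * σp)⁻¹ *
      (∫ z, F (x - u) (hbar / σp * z) * phaseFactor (p / σp * z) ∂stdGauss).re,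
    integral_const_mul, gaussSampling, integral_prod_symm _ hint]
  congr 1
  exact integral_re hint.integral_prod_right

lemma gaussSampling_add_const_mul (hF : QuadDecay F) (hG : QuadDecay G) (c : ℂ) (σ τ p x : ℝ) :
    gaussSampling (fun x y => F x y + c * G x y) σ τ p x =
      gaussSampling F σ τ p x + c * gaussSampling G σ τ p x := by
  unfold gaussSampling
  rw [← integral_const_mul, ← integral_add (hF.integrable_sampling σ τ p x)
    ((hG.integrable_sampling σ τ p x).const_mul c)]
  congr 1 with z
  ring

lemma hasDerivAt_gaussSampling_momentum (hb : hbar ≠ 0) (hF : QuadDecay F) (hG : QuadDecay G)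
    (hFG : ∀ x y, G x y = -Complex.I * (y / hbar : ℝ) * F x y) (s σ p x : ℝ) :
    HasDerivAt (fun p => gaussSampling F σ (hbar / s) (p / s) x)
      (gaussSampling G σ (hbar / s) (p / s) x) p := by
  obtain ⟨C, hC⟩ := hG.norm_le
  refine (hasDerivAt_integral_of_dominated_loc_of_deriv_le (s := univ) (bound := fun _ => C)
    (F' := fun (p : ℝ) (z : ℝ × ℝ) => G (x - σ * z.2) (hbar / s * z.1) *
      phaseFactor (p / s * z.1)) univ_mem
    (.of_forall fun p => (hF.integrable_sampling _ _ _ _).aestronglyMeasurable)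
    (hF.integrable_sampling _ _ _ _) (hG.integrable_sampling _ _ _ _).aestronglyMeasurable
    (ae_of_all _ fun z p _ => ?_) (integrable_const C) (ae_of_all _ fun z p _ => ?_)).2
  · rw [norm_mul, norm_phaseFactor, mul_one]
    exact hC _ _
  · have hphase : HasDerivAt (fun p => p / s * z.1) (1 / s * z.1) p :=
      ((hasDerivAt_id p).div_const s).mul_const z.1
    refine (((hasDerivAt_phaseFactor _).scomp p hphase).const_mul _).congr_deriv ?_
    rw [hFG, show hbar / s * z.1 / hbar = 1 / s * z.1 by field_simp, Complex.real_smul]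
    ring

end GaussSampling

section TimeEvolution

variable {hbar m : ℝ} {V : ℝ → ℝ}

lemma PolyGrowth.of_deriv (hV : Differentiable ℝ V) (hVg : PolyGrowth (deriv V)) :
    PolyGrowth V := by
  obtain ⟨C, k, hC⟩ := hVg
  have hC0 : 0 ≤ C := by simpa using (abs_nonneg _).trans (hC 0)
  refine ⟨|V 0| + C, k + 1, fun x => ?_⟩
  have hmvt : |V x - V 0| ≤ C * (1 + |x|) ^ k * |x| := by
    have hderiv : ∀ z ∈ Metric.closedBall (0 : ℝ) |x|, ‖deriv V z‖ ≤ C * (1 + |x|) ^ k := by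
      intro z hz
      rw [mem_closedBall_zero_iff, Real.norm_eq_abs] at hz
      exact (hC z).trans (by gcongr)
    simpa using (convex_closedBall (0 : ℝ) |x|).norm_image_sub_le_of_norm_deriv_le
      (fun z _ => hV z) hderiv (x := 0) (y := x) (by simp) (by simp)
  have hone : 1 ≤ (1 + |x|) ^ (k + 1) := one_le_pow₀ (by linarith [abs_nonneg x])
  calc |V x| ≤ |V 0| + |V x - V 0| := by linarith [abs_sub_abs_le_abs_sub (V x) (V 0)]
    _ ≤ |V 0| * 1 + C * (1 + |x|) ^ k * |x| := by rw [mul_one]; gcongr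
    _ ≤ |V 0| * (1 + |x|) ^ (k + 1) + C * (1 + |x|) ^ k * (1 + |x|) := by gcongr; linarith
    _ = (|V 0| + C) * (1 + |x|) ^ (k + 1) := by ring

/-- The potential part of the commutator with the Hamiltonian, on off-diagonal densities. -/
def potentialCommutator (hbar : ℝ) (V : ℝ → ℝ) (ψ : 𝓢(ℝ, ℂ)) (x y : ℝ) : ℂ :=
  -Complex.I / hbar * (crossDensity ψ ψ x y * (V (x + y / 2) - V (x - y / 2) : ℝ))

lemma quadDecay_potentialCommutator (hV : Continuous V) (hVg : PolyGrowth V) (ψ : 𝓢(ℝ, ℂ)) :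
    QuadDecay (potentialCommutator hbar V ψ) := by
  obtain ⟨C, k, hC⟩ := hVg
  refine (quadDecay_crossDensity_mul (C := C * 2) (k := k) ?_ (fun x y => ?_) ψ ψ).const_mul _
  · exact (by fun_prop : Continuous fun z : ℝ × ℝ => V (z.1 + z.2 / 2) - V (z.1 - z.2 / 2))
  · have hC0 : 0 ≤ C := by simpa using (abs_nonneg _).trans (hC 0)
    have hminus : 1 ≤ (1 + |x - y / 2|) ^ k := one_le_pow₀ (by linarith [abs_nonneg (x - y / 2)])
    have hplus : 1 ≤ (1 + |x + y / 2|) ^ k := one_le_pow₀ (by linarith [abs_nonneg (x + y / 2)])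
    calc |V (x + y / 2) - V (x - y / 2)|
        ≤ C * (1 + |x + y / 2|) ^ k + C * (1 + |x - y / 2|) ^ k :=
          (abs_sub _ _).trans (add_le_add (hC _) (hC _))
      _ ≤ C * 2 * ((1 + |x - y / 2|) ^ k * (1 + |x + y / 2|) ^ k) := by
          rw [← mul_add, mul_assoc]
          exact mul_le_mul_of_nonneg_left (by nlinarith) hC0

lemma potentialCommutator_eq (hV : ContDiff ℝ 1 V) (ψ : 𝓢(ℝ, ℂ)) (x y : ℝ) :
    potentialCommutator hbar V ψ x y =
      -Complex.I * (y / hbar : ℝ) * (crossDensity ψ ψ x y * forceMean V x y) := by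
  rw [potentialCommutator, ← mul_forceMean hV]
  push_cast
  ring

lemma eventually_one_add_abs_pow_mul_norm_le {ψ : ℝ → 𝓢(ℝ, ℂ)} {t : ℝ} (hψ : ContinuousAt ψ t)
    (k n : ℕ) : ∃ B, ∀ᶠ s in 𝓝 t, ∀ x : ℝ, (1 + |x|) ^ k * ‖iteratedDeriv n (ψ s) x‖ ≤ B := by
  set S : Seminorm ℝ 𝓢(ℝ, ℂ) := (Finset.Iic (k, n)).sup fun i => SchwartzMap.seminorm ℝ i.1 i.2
  have hS : Continuous S := Finset.sup_induction (p := fun q : Seminorm ℝ 𝓢(ℝ, ℂ) => Continuous q)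
    continuous_const (fun _ h _ h' => h.sup h')
    fun i _ => (schwartz_withSeminorms ℝ ℝ ℂ).continuous_seminorm i
  refine ⟨2 ^ k * (S (ψ t) + 1), ?_⟩
  filter_upwards [(hS.continuousAt.comp hψ).eventually (gt_mem_nhds (lt_add_one _))] with s hs x
  have hsup := one_add_le_sup_seminorm_apply (𝕜 := ℝ) (m := (k, n)) le_rfl le_rfl (ψ s) x
  rw [norm_iteratedFDeriv_eq_norm_iteratedDeriv] at hsup
  exact hsup.trans (by gcongr; exact hs.le)

lemma iteratedDeriv_two_eq_sderiv (ψ : 𝓢(ℝ, ℂ)) (x : ℝ) :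
    iteratedDeriv 2 ψ x = sderiv (sderiv ψ) x := by
  rw [iteratedDeriv_succ, iteratedDeriv_one, derivCLM_apply]
  congr 1

/-- The time derivative of a wave function as prescribed by the Schrödinger equation. -/
def timeDeriv (hbar m : ℝ) (V : ℝ → ℝ) (ψ : ℝ → ℂ) (x : ℝ) : ℂ :=
  hamiltonian hbar m V ψ x / (Complex.I * hbar)

lemma continuous_timeDeriv (hV : Continuous V) (ψ : 𝓢(ℝ, ℂ)) :
    Continuous (timeDeriv hbar m V ψ) := by
  unfold timeDeriv hamiltonian
  simp only [iteratedDeriv_two_eq_sderiv]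
  fun_prop

lemma eventually_norm_timeDeriv_le (hVg : PolyGrowth V) {ψ : ℝ → 𝓢(ℝ, ℂ)} {t : ℝ}
    (hψ : ContinuousAt ψ t) :
    ∃ B, ∀ᶠ s in 𝓝 t, ∀ x : ℝ, ‖ψ s x‖ ≤ B ∧ ‖timeDeriv hbar m V (ψ s) x‖ ≤ B := by
  obtain ⟨C, k, hC⟩ := hVg
  have hC0 : 0 ≤ C := by simpa using (abs_nonneg _).trans (hC 0)
  obtain ⟨B₀, h₀⟩ := eventually_one_add_abs_pow_mul_norm_le hψ 0 0
  obtain ⟨B₁, h₁⟩ := eventually_one_add_abs_pow_mul_norm_le hψ k 0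
  obtain ⟨B₂, h₂⟩ := eventually_one_add_abs_pow_mul_norm_le hψ 0 2
  simp only [pow_zero, one_mul, iteratedDeriv_zero] at h₀ h₁ h₂
  refine ⟨max B₀ ((|hbar ^ 2 / (2 * m)| * B₂ + C * B₁) / |hbar|), ?_⟩
  filter_upwards [h₀, h₁, h₂] with s h₀ h₁ h₂ x
  refine ⟨le_max_of_le_left (h₀ x), le_max_of_le_right ?_⟩
  have hpotential : ‖(V x : ℂ) * ψ s x‖ ≤ C * B₁ := by
    rw [norm_mul, Complex.norm_real, Real.norm_eq_abs]
    calc |V x| * ‖ψ s x‖ ≤ C * (1 + |x|) ^ k * ‖ψ s x‖ := by gcongr; exact hC x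
      _ ≤ C * B₁ := by rw [mul_assoc]; exact mul_le_mul_of_nonneg_left (h₁ x) hC0
  have hkinetic : ‖-((hbar ^ 2 / (2 * m) : ℝ) : ℂ) * iteratedDeriv 2 (ψ s) x‖ ≤
      |hbar ^ 2 / (2 * m)| * B₂ := by
    rw [norm_mul, norm_neg, Complex.norm_real, Real.norm_eq_abs]
    exact mul_le_mul_of_nonneg_left (h₂ x) (abs_nonneg _)
  rw [timeDeriv, norm_div, norm_mul, Complex.norm_I, one_mul, Complex.norm_real, Real.norm_eq_abs]
  gcongr
  exact (norm_add_le _ _).trans (add_le_add hkinetic hpotential)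

lemma norm_crossDensity_le {φ ψ : ℝ → ℂ} {B C : ℝ} (hφ : ∀ x, ‖φ x‖ ≤ B) (hψ : ∀ x, ‖ψ x‖ ≤ C)
    (x y : ℝ) : ‖crossDensity φ ψ x y‖ ≤ B * C := by
  rw [crossDensity, norm_mul, RCLike.norm_conj]
  exact mul_le_mul (hφ _) (hψ _) (norm_nonneg _) ((norm_nonneg _).trans (hφ 0))

lemma hasDerivAt_gaussSampling_time (hV : Continuous V) (hVg : PolyGrowth V) {I : Set ℝ}
    {ψ : ℝ → 𝓢(ℝ, ℂ)} (hI : IsOpen I) (hψ : ContinuousOn ψ I)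
    (hd : ∀ t ∈ I, ∀ x : ℝ, HasDerivAt (fun s => ψ s x) (timeDeriv hbar m V (ψ t) x) t)
    {t : ℝ} (ht : t ∈ I) (σ τ p x : ℝ) :
    HasDerivAt (fun s => gaussSampling (crossDensity (ψ s) (ψ s)) σ τ p x)
      (gaussSampling (fun x y => crossDensity (timeDeriv hbar m V (ψ t)) (ψ t) x y +
        crossDensity (ψ t) (timeDeriv hbar m V (ψ t)) x y) σ τ p x) t := by
  obtain ⟨B, hB⟩ := eventually_norm_timeDeriv_le (hbar := hbar) (m := m) hVg
    (hψ.continuousAt (hI.mem_nhds ht))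
  have hd' : Continuous (timeDeriv hbar m V (ψ t)) := continuous_timeDeriv hV (ψ t)
  have hpoint : Continuous fun z : ℝ × ℝ => (x - σ * z.2, τ * z.1) := by fun_prop
  refine (hasDerivAt_integral_of_dominated_loc_of_deriv_le (bound := fun _ => B * B + B * B)
    (F' := fun s (z : ℝ × ℝ) =>
      (crossDensity (timeDeriv hbar m V (ψ s)) (ψ s) (x - σ * z.2) (τ * z.1) +
        crossDensity (ψ s) (timeDeriv hbar m V (ψ s)) (x - σ * z.2) (τ * z.1)) *
      phaseFactor (p * z.1))
    (inter_mem (hI.mem_nhds ht) hB)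
    (.of_forall fun s =>
      ((quadDecay_crossDensity _ _).integrable_sampling _ _ _ _).aestronglyMeasurable)
    ((quadDecay_crossDensity _ _).integrable_sampling _ _ _ _) ?_
    (ae_of_all _ fun z s hs => ?_) (integrable_const _) (ae_of_all _ fun z s hs => ?_)).2
  · exact ((((continuous_crossDensity hd' (ψ t).continuous).comp hpoint).add
      ((continuous_crossDensity (ψ t).continuous hd').comp hpoint)).mul
        (by fun_prop)).aestronglyMeasurable
  · have hs' : ∀ x : ℝ, ‖ψ s x‖ ≤ B ∧ ‖timeDeriv hbar m V (ψ s) x‖ ≤ B := hs.2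
    rw [norm_mul, norm_phaseFactor, mul_one]
    exact (norm_add_le _ _).trans (add_le_add
      (norm_crossDensity_le (fun x => (hs' x).2) (fun x => (hs' x).1) _ _)
      (norm_crossDensity_le (fun x => (hs' x).1) (fun x => (hs' x).2) _ _))
  · exact ((hd s hs.1 _).star.mul (hd s hs.1 _)).mul_const _

end TimeEvolution

section BohmianGauge

variable {hbar m σp σx : ℝ} {V : ℝ → ℝ} {f g : ℝ → ℝ → ℝ}

/-- The first-moment density `p P(p,x)` of the Wigner function. -/
def momentDensity (hbar : ℝ) (ψ : 𝓢(ℝ, ℂ)) (p x : ℝ) : ℝ := p * wigner hbar ψ p x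

/-- The position derivative of the first-moment density. -/
def momentDensityDx (hbar : ℝ) (ψ : 𝓢(ℝ, ℂ)) (p x : ℝ) : ℝ := p * wignerDx hbar ψ p x

lemma rapidDecay_momentDensity (hb : hbar ≠ 0) (ψ : 𝓢(ℝ, ℂ)) :
    RapidDecay (momentDensity hbar ψ) :=
  (rapidDecay_wigner hb ψ).momentum_mul

lemma rapidDecay_momentDensityDx (hb : hbar ≠ 0) (ψ : 𝓢(ℝ, ℂ)) :
    RapidDecay (momentDensityDx hbar ψ) :=
  (rapidDecay_wignerDx hb ψ).momentum_mul

lemma hasDerivAt_momentDensity (ψ : 𝓢(ℝ, ℂ)) (p x : ℝ) :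
    HasDerivAt (momentDensity hbar ψ p) (momentDensityDx hbar ψ p x) x :=
  (hasDerivAt_wigner ψ p x).const_mul p

lemma smoothMomentum_eq (hbar σp σx : ℝ) (ψ : 𝓢(ℝ, ℂ)) :
    smoothMomentum hbar σp σx ψ = smooth σp σx (momentDensity hbar ψ) :=
  rfl

lemma regBohmianMomentum_eq (hb : hbar ≠ 0) (hp : 0 < σp) (hx : 0 < σx) (ψ : 𝓢(ℝ, ℂ)) :
    regBohmianMomentum hbar σp σx ψ = fun x =>
      gaussMarginal σx (momentDensity hbar ψ) x / gaussMarginal σx (wigner hbar ψ) x := by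
  ext x
  rw [regBohmianMomentum, husimi, smoothMomentum_eq,
    integral_smooth hp hx (rapidDecay_wigner hb ψ),
    integral_smooth hp hx (rapidDecay_momentDensity hb ψ)]

lemma bohmianGauge_eq (hb : hbar ≠ 0) (hp : 0 < σp) (hx : 0 < σx) (ψ : 𝓢(ℝ, ℂ)) (p x : ℝ) :
    bohmianGauge hbar m σp σx ψ p x = 1 / m * (regBohmianMomentum hbar σp σx ψ x *
      gaussAvg σx (fun q => gaussCdf σp (p - q)) (wigner hbar ψ) x -
        gaussAvg σx (fun q => gaussCdf σp (p - q)) (momentDensity hbar ψ) x) := by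
  rw [bohmianGauge, husimi, smoothMomentum_eq,
    setIntegral_Iic_smooth hp hx (rapidDecay_wigner hb ψ),
    setIntegral_Iic_smooth hp hx (rapidDecay_momentDensity hb ψ)]

lemma hasDerivAt_gaussMarginal (hf : RapidDecay f) (hg : RapidDecay g)
    (hd : ∀ p x, HasDerivAt (f p) (g p x) x) (σ x : ℝ) :
    HasDerivAt (gaussMarginal σ f) (gaussMarginal σ g x) x :=
  hasDerivAt_gaussAvg linearGrowth_one hf hg hd σ x

/-- The position derivative of the regularized Bohmian momentum, where the smoothed density does
not vanish. -/
def regBohmianMomentumDx (hbar σx : ℝ) (ψ : 𝓢(ℝ, ℂ)) (x : ℝ) : ℝ :=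
  (gaussMarginal σx (momentDensityDx hbar ψ) x * gaussMarginal σx (wigner hbar ψ) x -
    gaussMarginal σx (momentDensity hbar ψ) x * gaussMarginal σx (wignerDx hbar ψ) x) /
    gaussMarginal σx (wigner hbar ψ) x ^ 2

lemma hasDerivAt_regBohmianMomentum (hb : hbar ≠ 0) (hp : 0 < σp) (hx : 0 < σx) (ψ : 𝓢(ℝ, ℂ))
    {x : ℝ} (hN : gaussMarginal σx (wigner hbar ψ) x ≠ 0) :
    HasDerivAt (regBohmianMomentum hbar σp σx ψ) (regBohmianMomentumDx hbar σx ψ x) x := by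
  rw [regBohmianMomentum_eq hb hp hx]
  exact (hasDerivAt_gaussMarginal (rapidDecay_momentDensity hb ψ)
    (rapidDecay_momentDensityDx hb ψ) (hasDerivAt_momentDensity ψ) σx x).div
      (hasDerivAt_gaussMarginal (rapidDecay_wigner hb ψ) (rapidDecay_wignerDx hb ψ)
        (hasDerivAt_wigner ψ) σx x) hN

lemma integral_wigner (hb : 0 < hbar) (ψ : 𝓢(ℝ, ℂ)) (x : ℝ) :
    ∫ p, wigner hbar ψ p x = ‖ψ x‖ ^ 2 := by
  have h := integral_crossWigner hb ψ ψ x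
  simp only [← ofReal_wigner] at h
  rw [integral_complex_ofReal, Complex.conj_mul'] at h
  exact_mod_cast h

lemma gaussMarginal_wigner (hb : 0 < hbar) (ψ : 𝓢(ℝ, ℂ)) (σ x : ℝ) :
    gaussMarginal σ (wigner hbar ψ) x = ∫ z, ‖ψ (x - σ * z)‖ ^ 2 ∂stdGauss := by
  rw [gaussMarginal, gaussAvg_eq_integral_integral linearGrowth_one (rapidDecay_wigner hb.ne' ψ)]
  simp only [one_mul, integral_wigner hb]

lemma gaussMarginal_wigner_pos (hb : 0 < hbar) {σ : ℝ} (hσ : σ ≠ 0) {ψ : 𝓢(ℝ, ℂ)} {y : ℝ}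
    (hy : ψ y ≠ 0) (x : ℝ) : 0 < gaussMarginal σ (wigner hbar ψ) x := by
  rw [gaussMarginal_wigner hb]
  have : (stdGauss : Measure ℝ).IsOpenPosMeasure :=
    (gaussianReal_absolutelyContinuous' 0 one_ne_zero).isOpenPosMeasure
  have hcont : Continuous fun z => ‖ψ (x - σ * z)‖ ^ 2 := by fun_prop
  obtain ⟨C, -, hC⟩ := ψ.decay 0 0
  simp only [pow_zero, one_mul, norm_iteratedFDeriv_zero] at hC
  refine integral_pos_of_integrable_nonneg_nonzero (x := (x - y) / σ) hcont
    ((integrable_const (C ^ 2)).mono' hcont.aestronglyMeasurable (ae_of_all _ fun z => ?_))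
    (fun z => by positivity) ?_
  · rw [norm_pow, norm_norm]
    exact pow_le_pow_left₀ (norm_nonneg _) (hC _) 2
  · rw [mul_div_cancel₀ _ hσ, sub_sub_cancel]
    exact pow_ne_zero 2 (norm_ne_zero_iff.2 hy)

lemma differentiable_regBohmianMomentum (hb : 0 < hbar) (hp : 0 < σp) (hx : 0 < σx)
    (ψ : 𝓢(ℝ, ℂ)) : Differentiable ℝ (regBohmianMomentum hbar σp σx ψ) := by
  by_cases hψ : ∃ y, ψ y ≠ 0
  · obtain ⟨y, hy⟩ := hψ
    exact fun x => (hasDerivAt_regBohmianMomentum hb.ne' hp hx ψ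
      (gaussMarginal_wigner_pos hb hx.ne' hy x).ne').differentiableAt
  · push Not at hψ
    rw [regBohmianMomentum_eq hb.ne' hp hx]
    simp [gaussMarginal_wigner hb, hψ]

lemma hasDerivAt_bohmianGauge_position (hb : hbar ≠ 0) (hp : 0 < σp) (hx : 0 < σx) (ψ : 𝓢(ℝ, ℂ))
    {x d : ℝ} (hd : HasDerivAt (regBohmianMomentum hbar σp σx ψ) d x) (p : ℝ) :
    HasDerivAt (fun x => bohmianGauge hbar m σp σx ψ p x) (1 / m *
      (d * gaussAvg σx (fun q => gaussCdf σp (p - q)) (wigner hbar ψ) x +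
        regBohmianMomentum hbar σp σx ψ x *
          gaussAvg σx (fun q => gaussCdf σp (p - q)) (wignerDx hbar ψ) x -
        gaussAvg σx (fun q => gaussCdf σp (p - q)) (momentDensityDx hbar ψ) x)) x := by
  simp only [bohmianGauge_eq hb hp hx]
  have hk := linearGrowth_gaussCdf σp p
  exact ((hd.mul (hasDerivAt_gaussAvg hk (rapidDecay_wigner hb ψ) (rapidDecay_wignerDx hb ψ)
    (hasDerivAt_wigner ψ) σx x)).sub (hasDerivAt_gaussAvg hk (rapidDecay_momentDensity hb ψ)
      (rapidDecay_momentDensityDx hb ψ) (hasDerivAt_momentDensity ψ) σx x)).const_mul _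

lemma hasDerivAt_bohmianGauge_momentum (hb : hbar ≠ 0) (hp : 0 < σp) (hx : 0 < σx)
    (ψ : 𝓢(ℝ, ℂ)) (p x : ℝ) :
    HasDerivAt (fun p => bohmianGauge hbar m σp σx ψ p x)
      (1 / m * (regBohmianMomentum hbar σp σx ψ x * husimi hbar σp σx ψ p x -
        smoothMomentum hbar σp σx ψ p x)) p := by
  simp only [bohmianGauge_eq hb hp hx]
  exact (((hasDerivAt_gaussAvg_gaussCdf hp hx (rapidDecay_wigner hb ψ) p x).const_mul _).sub
    (hasDerivAt_gaussAvg_gaussCdf hp hx (rapidDecay_momentDensity hb ψ) p x)).const_mul _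

lemma husimiFlowX_eq (hb : 0 < hbar) (hm : m ≠ 0) (ψ : 𝓢(ℝ, ℂ)) (p x : ℝ) :
    husimiFlowX hbar m σp σx V ψ p x = 1 / m * smoothMomentum hbar σp σx ψ p x := by
  unfold husimiFlowX smoothMomentum smooth
  simp only [wignerFlowX_eq hb hm, mul_assoc, integral_const_mul]

lemma husimiFlowP_eq (hb : 0 < hbar) (hp : 0 < σp) (hx : 0 < σx) (hV : ContDiff ℝ 1 V)
    (hVg : PolyGrowth (deriv V)) (ψ : 𝓢(ℝ, ℂ)) (p x : ℝ) :
    husimiFlowP hbar m σp σx V ψ p x = -((√(2 * π) * σp)⁻¹ *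
      (gaussSampling (fun x y => crossDensity ψ ψ x y * forceMean V x y) σx (hbar / σp)
        (p / σp) x).re) := by
  rw [← smooth_re_partialFourier hp hx hb (quadDecay_crossDensity_mul_forceMean hV hVg ψ ψ)]
  unfold husimiFlowP smooth
  simp only [wignerFlowP_eq hb, neg_mul, integral_neg]

lemma bohmianFlowX_eq (hb : 0 < hbar) (hm : m ≠ 0) (hp : 0 < σp) (hx : 0 < σx) (ψ : 𝓢(ℝ, ℂ))
    (p x : ℝ) : bohmianFlowX hbar m σp σx V ψ p x =
      1 / m * (regBohmianMomentum hbar σp σx ψ x * husimi hbar σp σx ψ p x) := by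
  rw [bohmianFlowX, (hasDerivAt_bohmianGauge_momentum hb.ne' hp hx ψ p x).deriv,
    husimiFlowX_eq hb hm]
  ring

lemma bohmianFlowP_eq (hb : hbar ≠ 0) (hp : 0 < σp) (hx : 0 < σx) (ψ : 𝓢(ℝ, ℂ)) {x d : ℝ}
    (hd : HasDerivAt (regBohmianMomentum hbar σp σx ψ) d x) (p : ℝ) :
    bohmianFlowP hbar m σp σx V ψ p x = husimiFlowP hbar m σp σx V ψ p x - 1 / m *
      (d * gaussAvg σx (fun q => gaussCdf σp (p - q)) (wigner hbar ψ) x +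
        regBohmianMomentum hbar σp σx ψ x *
          gaussAvg σx (fun q => gaussCdf σp (p - q)) (wignerDx hbar ψ) x -
        gaussAvg σx (fun q => gaussCdf σp (p - q)) (momentDensityDx hbar ψ) x) := by
  rw [bohmianFlowP, (hasDerivAt_bohmianGauge_position hb hp hx ψ hd p).deriv]
  exact (sub_eq_add_neg _ _).symm

end BohmianGauge

section Continuity

variable {hbar m σp σx : ℝ} {V : ℝ → ℝ}

/-- The off-diagonal function whose Fourier transform is the position derivative of the
first-moment density. -/
def momentKernel (hbar : ℝ) (ψ : 𝓢(ℝ, ℂ)) (x y : ℝ) : ℂ :=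
  -Complex.I * hbar / 2 *
    (crossDensity ψ (sderiv (sderiv ψ)) x y - crossDensity (sderiv (sderiv ψ)) ψ x y)

lemma quadDecay_momentKernel (ψ : 𝓢(ℝ, ℂ)) : QuadDecay (momentKernel hbar ψ) :=
  ((quadDecay_crossDensity _ _).sub (quadDecay_crossDensity _ _)).const_mul _

lemma momentDensityDx_eq (hb : hbar ≠ 0) (ψ : 𝓢(ℝ, ℂ)) :
    momentDensityDx hbar ψ = fun p x => (partialFourier hbar (momentKernel hbar ψ) p x).re := by
  ext p x
  unfold momentKernel
  rw [partialFourier_const_mul,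
    (quadDecay_crossDensity _ _).partialFourier_sub (quadDecay_crossDensity _ _),
    momentDensityDx, wignerDx, ← Complex.add_re, ← Complex.re_ofReal_mul, mul_add,
    momentum_mul_crossWigner hb, momentum_mul_crossWigner hb]
  congr 1
  unfold crossWigner
  ring

/-- The von Neumann equation for off-diagonal densities: the kinetic part of the commutator with
the Hamiltonian is the kernel of `-∂ₓ(p P) / m`. -/
lemma crossDensity_timeDeriv (hb : hbar ≠ 0) (hm : m ≠ 0) (ψ : 𝓢(ℝ, ℂ)) (x y : ℝ) :
    crossDensity (timeDeriv hbar m V ψ) ψ x y + crossDensity ψ (timeDeriv hbar m V ψ) x y =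
      potentialCommutator hbar V ψ x y + (-(1 / m) : ℝ) * momentKernel hbar ψ x y := by
  have hbC : (hbar : ℂ) ≠ 0 := by exact_mod_cast hb
  have hmC : (m : ℂ) ≠ 0 := by exact_mod_cast hm
  simp only [crossDensity, potentialCommutator, momentKernel, timeDeriv, hamiltonian,
    iteratedDeriv_two_eq_sderiv, map_div₀, map_add, map_mul, map_neg, Complex.conj_ofReal,
    Complex.conj_I, div_mul_eq_div_div, Complex.div_I]
  push_cast
  field_simp
  ring

lemma husimi_eq_gaussSampling (hb : 0 < hbar) (hp : 0 < σp) (hx : 0 < σx) (ψ : 𝓢(ℝ, ℂ))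
    (p x : ℝ) : husimi hbar σp σx ψ p x =
      (√(2 * π) * σp)⁻¹ * (gaussSampling (crossDensity ψ ψ) σx (hbar / σp) (p / σp) x).re := by
  rw [← smooth_re_partialFourier hp hx hb (quadDecay_crossDensity _ _), husimi, wigner_eq_re]
  rfl

lemma smooth_momentDensityDx (hb : 0 < hbar) (hp : 0 < σp) (hx : 0 < σx) (ψ : 𝓢(ℝ, ℂ))
    (p x : ℝ) : smooth σp σx (momentDensityDx hbar ψ) p x =
      (√(2 * π) * σp)⁻¹ * (gaussSampling (momentKernel hbar ψ) σx (hbar / σp) (p / σp) x).re := by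
  rw [← smooth_re_partialFourier hp hx hb (quadDecay_momentKernel _), momentDensityDx_eq hb.ne']

lemma hasDerivAt_husimi_time (hb : 0 < hbar) (hm : m ≠ 0) (hV : Continuous V)
    (hVg : PolyGrowth V) {I : Set ℝ} {ψ : ℝ → 𝓢(ℝ, ℂ)} (hI : IsOpen I) (hψ : ContinuousOn ψ I)
    (hd : ∀ t ∈ I, ∀ x : ℝ, HasDerivAt (fun s => ψ s x) (timeDeriv hbar m V (ψ t) x) t)
    (hp : 0 < σp) (hx : 0 < σx) {t : ℝ} (ht : t ∈ I) (p x : ℝ) :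
    HasDerivAt (fun s => husimi hbar σp σx (ψ s) p x)
      ((√(2 * π) * σp)⁻¹ *
          (gaussSampling (potentialCommutator hbar V (ψ t)) σx (hbar / σp) (p / σp) x).re -
        1 / m * smooth σp σx (momentDensityDx hbar (ψ t)) p x) t := by
  have h := hasDerivAt_gaussSampling_time hV hVg hI hψ hd ht σx (hbar / σp) (p / σp) x
  simp only [crossDensity_timeDeriv hb.ne' hm] at h
  rw [gaussSampling_add_const_mul (quadDecay_potentialCommutator hV hVg _)
    (quadDecay_momentKernel _)] at h
  simp only [husimi_eq_gaussSampling hb hp hx]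
  refine ((Complex.reCLM.hasFDerivAt.comp_hasDerivAt t h).const_mul _).congr_deriv ?_
  rw [smooth_momentDensityDx hb hp hx, Complex.reCLM_apply, Complex.add_re, Complex.re_ofReal_mul]
  ring

lemma hasDerivAt_bohmianFlowP (hb : 0 < hbar) (hV : ContDiff ℝ 1 V) (hVg : PolyGrowth (deriv V))
    (hp : 0 < σp) (hx : 0 < σx) (ψ : 𝓢(ℝ, ℂ)) {x d : ℝ}
    (hd : HasDerivAt (regBohmianMomentum hbar σp σx ψ) d x) (p : ℝ) :
    HasDerivAt (fun p => bohmianFlowP hbar m σp σx V ψ p x)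
      (-((√(2 * π) * σp)⁻¹ *
          (gaussSampling (potentialCommutator hbar V ψ) σx (hbar / σp) (p / σp) x).re) -
        1 / m * (d * husimi hbar σp σx ψ p x + regBohmianMomentum hbar σp σx ψ x *
          smooth σp σx (wignerDx hbar ψ) p x - smooth σp σx (momentDensityDx hbar ψ) p x)) p := by
  have hforce := hasDerivAt_gaussSampling_momentum hb.ne'
    (quadDecay_crossDensity_mul_forceMean hV hVg ψ ψ)
    (quadDecay_potentialCommutator hV.continuous (.of_deriv (hV.differentiable one_ne_zero) hVg) ψ)
    (potentialCommutator_eq hV ψ) σp σx p x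
  simp only [bohmianFlowP_eq hb.ne' hp hx ψ hd, husimiFlowP_eq hb hp hx hV hVg]
  exact ((Complex.reCLM.hasFDerivAt.comp_hasDerivAt p hforce).const_mul _).neg.sub
    (((((hasDerivAt_gaussAvg_gaussCdf hp hx (rapidDecay_wigner hb.ne' ψ) p x).const_mul d).add
      ((hasDerivAt_gaussAvg_gaussCdf hp hx (rapidDecay_wignerDx hb.ne' ψ) p x).const_mul _)).sub
        (hasDerivAt_gaussAvg_gaussCdf hp hx (rapidDecay_momentDensityDx hb.ne' ψ) p x)).const_mul
          _)

lemma hasDerivAt_bohmianFlowX (hb : 0 < hbar) (hm : m ≠ 0) (hp : 0 < σp) (hx : 0 < σx)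
    (ψ : 𝓢(ℝ, ℂ)) {x d : ℝ} (hd : HasDerivAt (regBohmianMomentum hbar σp σx ψ) d x) (p : ℝ) :
    HasDerivAt (fun x => bohmianFlowX hbar m σp σx V ψ p x)
      (1 / m * (d * husimi hbar σp σx ψ p x + regBohmianMomentum hbar σp σx ψ x *
        smooth σp σx (wignerDx hbar ψ) p x)) x := by
  simp only [bohmianFlowX_eq hb hm hp hx]
  exact (hd.mul (hasDerivAt_smooth hp hx (rapidDecay_wigner hb.ne' ψ)
    (rapidDecay_wignerDx hb.ne' ψ) (hasDerivAt_wigner ψ) p x)).const_mul _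

theorem continuity_equation (hb : 0 < hbar) (hm : m ≠ 0) (hV : ContDiff ℝ 1 V)
    (hVg : PolyGrowth (deriv V)) {I : Set ℝ} {ψ : ℝ → 𝓢(ℝ, ℂ)} (hI : IsOpen I)
    (hψ : ContinuousOn ψ I)
    (hd : ∀ t ∈ I, ∀ x : ℝ, HasDerivAt (fun s => ψ s x) (timeDeriv hbar m V (ψ t) x) t)
    (hp : 0 < σp) (hx : 0 < σx) {t : ℝ} (ht : t ∈ I) (p x : ℝ) :
    DifferentiableAt ℝ (fun s => husimi hbar σp σx (ψ s) p x) t ∧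
    DifferentiableAt ℝ (fun p => bohmianFlowP hbar m σp σx V (ψ t) p x) p ∧
    DifferentiableAt ℝ (fun x => bohmianFlowX hbar m σp σx V (ψ t) p x) x ∧
    deriv (fun s => husimi hbar σp σx (ψ s) p x) t =
      -deriv (fun p => bohmianFlowP hbar m σp σx V (ψ t) p x) p
      - deriv (fun x => bohmianFlowX hbar m σp σx V (ψ t) p x) x := by
  have hpB := (differentiable_regBohmianMomentum hb hp hx (ψ t) x).hasDerivAt
  have hQ := hasDerivAt_husimi_time hb hm hV.continuous
    (.of_deriv (hV.differentiable one_ne_zero) hVg) hI hψ hd hp hx ht p x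
  have hP := hasDerivAt_bohmianFlowP (m := m) hb hV hVg hp hx (ψ t) hpB p
  have hX := hasDerivAt_bohmianFlowX (V := V) hb hm hp hx (ψ t) hpB p
  refine ⟨hQ.differentiableAt, hP.differentiableAt, hX.differentiableAt, ?_⟩
  rw [hQ.deriv, hP.deriv, hX.deriv]
  ring

end Continuity

section Moments

variable {hbar : ℝ}

lemma integral_re_crossWigner (hb : 0 < hbar) (φ χ : 𝓢(ℝ, ℂ)) (x : ℝ) :
    ∫ p, (crossWigner hbar φ χ p x).re = (φ x).re * (χ x).re + (φ x).im * (χ x).im := by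
  have h := integral_re (integrable_crossWigner hb.ne' φ χ x)
  rw [integral_crossWigner hb] at h
  simpa [Complex.mul_re] using h

lemma integral_im_crossWigner (hb : 0 < hbar) (φ χ : 𝓢(ℝ, ℂ)) (x : ℝ) :
    ∫ p, (crossWigner hbar φ χ p x).im = (φ x).re * (χ x).im - (φ x).im * (χ x).re := by
  have h := integral_im (integrable_crossWigner hb.ne' φ χ x)
  rw [integral_crossWigner hb] at h
  simpa [Complex.mul_im, sub_eq_add_neg] using h

/-- The position density `|ψ|²`, in real coordinates. -/
def density (ψ : 𝓢(ℝ, ℂ)) (x : ℝ) : ℝ := (ψ x).re ^ 2 + (ψ x).im ^ 2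

/-- The first derivative of the position density. -/
def densityD1 (ψ : 𝓢(ℝ, ℂ)) (x : ℝ) : ℝ :=
  2 * ((ψ x).re * (sderiv ψ x).re + (ψ x).im * (sderiv ψ x).im)

/-- The second derivative of the position density. -/
def densityD2 (ψ : 𝓢(ℝ, ℂ)) (x : ℝ) : ℝ :=
  2 * ((sderiv ψ x).re ^ 2 + (sderiv ψ x).im ^ 2 +
    (ψ x).re * (sderiv (sderiv ψ) x).re + (ψ x).im * (sderiv (sderiv ψ) x).im)

/-- The third derivative of the position density. -/
def densityD3 (ψ : 𝓢(ℝ, ℂ)) (x : ℝ) : ℝ :=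
  2 * (3 * ((sderiv ψ x).re * (sderiv (sderiv ψ) x).re +
      (sderiv ψ x).im * (sderiv (sderiv ψ) x).im) +
    (ψ x).re * (sderiv (sderiv (sderiv ψ)) x).re + (ψ x).im * (sderiv (sderiv (sderiv ψ)) x).im)

/-- The momentum current `ℏ Im (ψ* ψ')`: the first moment of the Wigner function in `p`, and `m`
times the probability current. -/
def current (hbar : ℝ) (ψ : 𝓢(ℝ, ℂ)) (x : ℝ) : ℝ :=
  hbar * ((ψ x).re * (sderiv ψ x).im - (ψ x).im * (sderiv ψ x).re)

/-- The derivative of the momentum current. -/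
def currentD1 (hbar : ℝ) (ψ : 𝓢(ℝ, ℂ)) (x : ℝ) : ℝ :=
  hbar * ((ψ x).re * (sderiv (sderiv ψ) x).im - (ψ x).im * (sderiv (sderiv ψ) x).re)

/-- The position derivative of the second moment of the Wigner function in `p`. -/
def secondMomentD1 (hbar : ℝ) (ψ : 𝓢(ℝ, ℂ)) (x : ℝ) : ℝ :=
  hbar ^ 2 / 2 * ((sderiv ψ x).re * (sderiv (sderiv ψ) x).re +
    (sderiv ψ x).im * (sderiv (sderiv ψ) x).im -
    (ψ x).re * (sderiv (sderiv (sderiv ψ)) x).re - (ψ x).im * (sderiv (sderiv (sderiv ψ)) x).im)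

lemma norm_sq_eq_density (ψ : 𝓢(ℝ, ℂ)) (x : ℝ) : ‖ψ x‖ ^ 2 = density ψ x := by
  rw [← Complex.normSq_eq_norm_sq, Complex.normSq_apply, density, sq, sq]

lemma integral_wigner_eq_density (hb : 0 < hbar) (ψ : 𝓢(ℝ, ℂ)) (x : ℝ) :
    ∫ p, wigner hbar ψ p x = density ψ x := by
  rw [integral_wigner hb, norm_sq_eq_density]

lemma integral_wignerDx (hb : 0 < hbar) (ψ : 𝓢(ℝ, ℂ)) (x : ℝ) :
    ∫ p, wignerDx hbar ψ p x = densityD1 ψ x := by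
  unfold wignerDx
  rw [integral_add ((rapidDecay_re_crossWigner hb.ne' _ _).integrable x)
    ((rapidDecay_re_crossWigner hb.ne' _ _).integrable x),
    integral_re_crossWigner hb, integral_re_crossWigner hb, densityD1]
  ring

lemma momentum_mul_re_crossWigner (hb : hbar ≠ 0) (φ χ : 𝓢(ℝ, ℂ)) (p x : ℝ) :
    p * (crossWigner hbar φ χ p x).re = hbar / 2 *
      ((crossWigner hbar φ (sderiv χ) p x).im - (crossWigner hbar (sderiv φ) χ p x).im) := by
  rw [← Complex.re_ofReal_mul, momentum_mul_crossWigner hb, ← Complex.sub_im]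
  simp [Complex.mul_re]
  ring

lemma momentum_mul_im_crossWigner (hb : hbar ≠ 0) (φ χ : 𝓢(ℝ, ℂ)) (p x : ℝ) :
    p * (crossWigner hbar φ χ p x).im = -(hbar / 2) *
      ((crossWigner hbar φ (sderiv χ) p x).re - (crossWigner hbar (sderiv φ) χ p x).re) := by
  rw [← Complex.im_ofReal_mul, momentum_mul_crossWigner hb, ← Complex.sub_re]
  simp [Complex.mul_im]
  ring

lemma momentDensity_eq_im (hb : hbar ≠ 0) (ψ : 𝓢(ℝ, ℂ)) (p x : ℝ) :
    momentDensity hbar ψ p x = hbar / 2 *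
      ((crossWigner hbar ψ (sderiv ψ) p x).im - (crossWigner hbar (sderiv ψ) ψ p x).im) := by
  rw [momentDensity, wigner_eq_re, momentum_mul_re_crossWigner hb]

lemma momentDensityDx_eq_im (hb : hbar ≠ 0) (ψ : 𝓢(ℝ, ℂ)) (p x : ℝ) :
    momentDensityDx hbar ψ p x = hbar / 2 * ((crossWigner hbar ψ (sderiv (sderiv ψ)) p x).im -
      (crossWigner hbar (sderiv (sderiv ψ)) ψ p x).im) := by
  rw [momentDensityDx, wignerDx, mul_add, momentum_mul_re_crossWigner hb,
    momentum_mul_re_crossWigner hb]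
  ring

lemma integral_im_crossWigner_sub (hb : 0 < hbar) (φ χ : 𝓢(ℝ, ℂ)) (x : ℝ) :
    ∫ p, hbar / 2 * ((crossWigner hbar φ χ p x).im - (crossWigner hbar χ φ p x).im) =
      hbar * ((φ x).re * (χ x).im - (φ x).im * (χ x).re) := by
  have hint (φ χ : 𝓢(ℝ, ℂ)) : Integrable fun p => (crossWigner hbar φ χ p x).im :=
    (integrable_crossWigner hb.ne' φ χ x).im
  rw [integral_const_mul, integral_sub (hint φ χ) (hint χ φ), integral_im_crossWigner hb,
    integral_im_crossWigner hb]
  ring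

lemma integral_momentDensity (hb : 0 < hbar) (ψ : 𝓢(ℝ, ℂ)) (x : ℝ) :
    ∫ p, momentDensity hbar ψ p x = current hbar ψ x := by
  simp only [momentDensity_eq_im hb.ne', integral_im_crossWigner_sub hb, current]

lemma integral_momentDensityDx (hb : 0 < hbar) (ψ : 𝓢(ℝ, ℂ)) (x : ℝ) :
    ∫ p, momentDensityDx hbar ψ p x = currentD1 hbar ψ x := by
  simp only [momentDensityDx_eq_im hb.ne', integral_im_crossWigner_sub hb, currentD1]

lemma integral_momentum_mul_momentDensityDx (hb : 0 < hbar) (ψ : 𝓢(ℝ, ℂ)) (x : ℝ) :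
    ∫ p, p * momentDensityDx hbar ψ p x = secondMomentD1 hbar ψ x := by
  have hre (p : ℝ) : p * momentDensityDx hbar ψ p x = -(hbar ^ 2 / 4) *
      (((crossWigner hbar ψ (sderiv (sderiv (sderiv ψ))) p x).re -
        (crossWigner hbar (sderiv ψ) (sderiv (sderiv ψ)) p x).re) -
      ((crossWigner hbar (sderiv (sderiv ψ)) (sderiv ψ) p x).re -
        (crossWigner hbar (sderiv (sderiv (sderiv ψ))) ψ p x).re)) := by
    rw [momentDensityDx_eq_im hb.ne', mul_left_comm, mul_sub, momentum_mul_im_crossWigner hb.ne',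
      momentum_mul_im_crossWigner hb.ne']
    ring
  have hint (φ χ : 𝓢(ℝ, ℂ)) : Integrable fun p => (crossWigner hbar φ χ p x).re :=
    (rapidDecay_re_crossWigner hb.ne' φ χ).integrable x
  have hsub (φ χ φ' χ' : 𝓢(ℝ, ℂ)) : Integrable fun p =>
      (crossWigner hbar φ χ p x).re - (crossWigner hbar φ' χ' p x).re :=
    (hint φ χ).sub (hint φ' χ')
  simp only [hre]
  rw [integral_const_mul, integral_sub (hsub _ _ _ _) (hsub _ _ _ _),
    integral_sub (hint _ _) (hint _ _), integral_sub (hint _ _) (hint _ _)]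
  simp only [integral_re_crossWigner hb, secondMomentD1]
  ring

end Moments

section QuantumPotential

variable {hbar m : ℝ} {ψ : 𝓢(ℝ, ℂ)} {x : ℝ}

lemma hasDerivAt_re_schwartz (ψ : 𝓢(ℝ, ℂ)) (x : ℝ) :
    HasDerivAt (fun x => (ψ x).re) (sderiv ψ x).re x :=
  Complex.reCLM.hasFDerivAt.comp_hasDerivAt x (hasDerivAt_sderiv ψ x)

lemma hasDerivAt_im_schwartz (ψ : 𝓢(ℝ, ℂ)) (x : ℝ) :
    HasDerivAt (fun x => (ψ x).im) (sderiv ψ x).im x :=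
  Complex.imCLM.hasFDerivAt.comp_hasDerivAt x (hasDerivAt_sderiv ψ x)

lemma hasDerivAt_density (ψ : 𝓢(ℝ, ℂ)) (x : ℝ) : HasDerivAt (density ψ) (densityD1 ψ x) x := by
  refine (((hasDerivAt_re_schwartz ψ x).pow 2).add
    ((hasDerivAt_im_schwartz ψ x).pow 2)).congr_deriv ?_
  rw [densityD1]
  push_cast
  ring

lemma hasDerivAt_densityD1 (ψ : 𝓢(ℝ, ℂ)) (x : ℝ) :
    HasDerivAt (densityD1 ψ) (densityD2 ψ x) x := by
  refine ((((hasDerivAt_re_schwartz ψ x).mul (hasDerivAt_re_schwartz (sderiv ψ) x)).add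
    ((hasDerivAt_im_schwartz ψ x).mul
      (hasDerivAt_im_schwartz (sderiv ψ) x))).const_mul 2).congr_deriv ?_
  rw [densityD2]
  ring

lemma hasDerivAt_densityD2 (ψ : 𝓢(ℝ, ℂ)) (x : ℝ) :
    HasDerivAt (densityD2 ψ) (densityD3 ψ x) x := by
  have hre := hasDerivAt_re_schwartz (sderiv ψ) x
  have him := hasDerivAt_im_schwartz (sderiv ψ) x
  refine (((((hre.pow 2).add (him.pow 2)).add
    ((hasDerivAt_re_schwartz ψ x).mul (hasDerivAt_re_schwartz (sderiv (sderiv ψ)) x))).add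
    ((hasDerivAt_im_schwartz ψ x).mul
      (hasDerivAt_im_schwartz (sderiv (sderiv ψ)) x))).const_mul 2).congr_deriv ?_
  rw [densityD3]
  push_cast
  ring

lemma density_pos (h : ψ x ≠ 0) : 0 < density ψ x := by
  rw [← norm_sq_eq_density]
  exact pow_pos (norm_pos_iff.2 h) 2

lemma hasDerivAt_norm_schwartz (h : ψ x ≠ 0) :
    HasDerivAt (fun z => ‖ψ z‖) (densityD1 ψ x / (2 * ‖ψ x‖)) x := by
  have hsqrt (z : ℝ) : √(density ψ z) = ‖ψ z‖ := by
    rw [← norm_sq_eq_density, Real.sqrt_sq (norm_nonneg _)]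
  simpa only [hsqrt] using (hasDerivAt_density ψ x).sqrt (density_pos h).ne'

lemma quantumPotential_eq (h : ψ x ≠ 0) : quantumPotential hbar m ψ x =
    -(hbar ^ 2 / (2 * m)) * (densityD2 ψ x / (2 * density ψ x) -
      densityD1 ψ x ^ 2 / (4 * density ψ x ^ 2)) := by
  have hne : ‖ψ x‖ ≠ 0 := norm_ne_zero_iff.2 h
  have hderiv : deriv (fun z => ‖ψ z‖) =ᶠ[𝓝 x] fun z => densityD1 ψ z / (2 * ‖ψ z‖) :=
    (ψ.continuous.continuousAt.eventually_ne h).mono fun z hz => (hasDerivAt_norm_schwartz hz).deriv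
  have hderiv₂ : HasDerivAt (fun z => densityD1 ψ z / (2 * ‖ψ z‖)) _ x :=
    (hasDerivAt_densityD1 ψ x).div ((hasDerivAt_norm_schwartz h).const_mul 2)
      (mul_ne_zero two_ne_zero hne)
  rw [quantumPotential, iteratedDeriv_succ, iteratedDeriv_one, hderiv.deriv_eq, hderiv₂.deriv,
    ← norm_sq_eq_density, div_mul_eq_div_div]
  field_simp
  ring

/-- The derivative of the quantum potential, where the density does not vanish. -/
def quantumPotentialD1 (hbar m : ℝ) (ψ : 𝓢(ℝ, ℂ)) (x : ℝ) : ℝ :=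
  -(hbar ^ 2 / (2 * m)) * (densityD3 ψ x / (2 * density ψ x) -
    densityD1 ψ x * densityD2 ψ x / density ψ x ^ 2 + densityD1 ψ x ^ 3 / (2 * density ψ x ^ 3))

lemma hasDerivAt_quantumPotential (h : ψ x ≠ 0) :
    HasDerivAt (quantumPotential hbar m ψ) (quantumPotentialD1 hbar m ψ x) x := by
  have hn := (density_pos h).ne'
  have hd := hasDerivAt_density ψ x
  refine HasDerivAt.congr_of_eventuallyEq ?_
    ((ψ.continuous.continuousAt.eventually_ne h).mono fun z hz => quantumPotential_eq hz)
  refine ((((hasDerivAt_densityD2 ψ x).div (hd.const_mul 2) (mul_ne_zero two_ne_zero hn)).sub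
    (((hasDerivAt_densityD1 ψ x).pow 2).div ((hd.pow 2).const_mul 4)
      (mul_ne_zero four_ne_zero (pow_ne_zero 2 hn)))).const_mul _).congr_deriv ?_
  simp only [Pi.pow_apply, quantumPotentialD1]
  push_cast
  field_simp
  ring

lemma bohmianMomentum_eq (hbar : ℝ) (ψ : 𝓢(ℝ, ℂ)) (x : ℝ) :
    bohmianMomentum hbar ψ x = current hbar ψ x / density ψ x := by
  have hnormSq : Complex.normSq (ψ x) = density ψ x := by
    rw [Complex.normSq_eq_norm_sq, norm_sq_eq_density]
  rw [bohmianMomentum, ← derivCLM_apply ℂ ψ x, Complex.div_re, hnormSq, current, ← add_div]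
  congr 1
  simp
  ring

/-- The derivative of the Bohmian momentum, where the density does not vanish. -/
def bohmianMomentumD1 (hbar : ℝ) (ψ : 𝓢(ℝ, ℂ)) (x : ℝ) : ℝ :=
  (currentD1 hbar ψ x * density ψ x - current hbar ψ x * densityD1 ψ x) / density ψ x ^ 2

/-- The momentum dispersion `∫ p² P dp - p_B ∫ p P dp` has the quantum force as its divergence. -/
lemma secondMomentD1_sub_eq_quantumPotentialD1 (hm : m ≠ 0) (h : ψ x ≠ 0) :
    secondMomentD1 hbar ψ x - (bohmianMomentumD1 hbar ψ x * current hbar ψ x +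
      bohmianMomentum hbar ψ x * currentD1 hbar ψ x) =
        m * (density ψ x * quantumPotentialD1 hbar m ψ x) := by
  have hn := (density_pos h).ne'
  have hdensity : density ψ x = (ψ x).re ^ 2 + (ψ x).im ^ 2 := rfl
  simp only [bohmianMomentum_eq, bohmianMomentumD1, quantumPotentialD1, densityD1, densityD2,
    densityD3, current, currentD1, secondMomentD1]
  generalize density ψ x = n at hn hdensity ⊢
  field_simp
  rw [hdensity]
  ring

end QuantumPotential

section SingularLimit

variable {hbar m : ℝ} {V : ℝ → ℝ} {ψ : 𝓢(ℝ, ℂ)} {x : ℝ}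

lemma tendsto_gaussSampling {ι : Type*} {l : Filter ι} [l.IsCountablyGenerated] {F : ℝ → ℝ → ℂ}
    (hF : QuadDecay F) {σ τ r : ι → ℝ} (hσ : Tendsto σ l (𝓝 0)) (hτ : Tendsto τ l (𝓝 0))
    (hr : Tendsto r l (𝓝 0)) (x : ℝ) :
    Tendsto (fun i => gaussSampling F (σ i) (τ i) (r i) x) l (𝓝 (F x 0)) := by
  obtain ⟨C, hC⟩ := hF.norm_le
  have hconst : F x 0 = ∫ _ : ℝ × ℝ, F x 0 ∂(stdGauss.prod stdGauss) := by simp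
  rw [hconst]
  refine tendsto_integral_filter_of_dominated_convergence (fun _ => C)
    (.of_forall fun i => (hF.integrable_sampling _ _ _ _).aestronglyMeasurable)
    (.of_forall fun i => ae_of_all _ fun z => ?_) (integrable_const C) (ae_of_all _ fun z => ?_)
  · rw [norm_mul, norm_phaseFactor, mul_one]
    exact hC _ _
  · have hpoint : Tendsto (fun i => (x - σ i * z.2, τ i * z.1)) l (𝓝 (x, 0)) :=
      (by simpa using tendsto_const_nhds.sub (hσ.mul_const z.2) :
        Tendsto (fun i => x - σ i * z.2) l (𝓝 x)).prodMk_nhds (by simpa using hτ.mul_const z.1)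
    have hphase : Tendsto (fun i => phaseFactor (r i * z.1)) l (𝓝 1) := by
      simpa [Function.comp_def, phaseFactor_zero] using
        (continuous_phaseFactor.tendsto _).comp (hr.mul_const z.1)
    simpa using ((hF.continuous.tendsto (x, 0)).comp hpoint).mul hphase

lemma tendsto_scaled_husimi (hb : 0 < hbar) (ψ : 𝓢(ℝ, ℂ)) (p x : ℝ) :
    Tendsto (fun σ : ℝ × ℝ => √(2 * π) * σ.1 * husimi hbar σ.1 σ.2 ψ p x)
      bohmianLimit (𝓝 (density ψ x)) := by
  rw [← integral_wigner_eq_density hb]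
  exact tendsto_smooth (rapidDecay_wigner hb.ne' ψ) p x

lemma tendsto_gaussMarginal_wigner (hb : 0 < hbar) (ψ : 𝓢(ℝ, ℂ)) (x : ℝ) :
    Tendsto (fun σ : ℝ × ℝ => gaussMarginal σ.2 (wigner hbar ψ) x) bohmianLimit
      (𝓝 (density ψ x)) := by
  rw [← integral_wigner_eq_density hb]
  exact tendsto_gaussMarginal (rapidDecay_wigner hb.ne' ψ) x

lemma tendsto_gaussMarginal_momentDensity (hb : 0 < hbar) (ψ : 𝓢(ℝ, ℂ)) (x : ℝ) :
    Tendsto (fun σ : ℝ × ℝ => gaussMarginal σ.2 (momentDensity hbar ψ) x) bohmianLimit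
      (𝓝 (current hbar ψ x)) := by
  rw [← integral_momentDensity hb]
  exact tendsto_gaussMarginal (rapidDecay_momentDensity hb.ne' ψ) x

lemma tendsto_regBohmianMomentum (hb : 0 < hbar) (h : ψ x ≠ 0) :
    Tendsto (fun σ : ℝ × ℝ => regBohmianMomentum hbar σ.1 σ.2 ψ x) bohmianLimit
      (𝓝 (bohmianMomentum hbar ψ x)) := by
  rw [bohmianMomentum_eq]
  refine ((tendsto_gaussMarginal_momentDensity hb ψ x).div (tendsto_gaussMarginal_wigner hb ψ x)
    (density_pos h).ne').congr' ?_
  filter_upwards [eventually_bohmianLimit_pos] with σ ⟨hp, hx⟩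
  rw [regBohmianMomentum_eq hb.ne' hp hx]
  rfl

lemma tendsto_regBohmianMomentumDx (hb : 0 < hbar) (h : ψ x ≠ 0) :
    Tendsto (fun σ : ℝ × ℝ => regBohmianMomentumDx hbar σ.2 ψ x) bohmianLimit
      (𝓝 (bohmianMomentumD1 hbar ψ x)) := by
  have hwigner := tendsto_gaussMarginal_wigner hb ψ x
  have hwignerDx := tendsto_gaussMarginal (rapidDecay_wignerDx hb.ne' ψ) x
  have hmomentDx := tendsto_gaussMarginal (rapidDecay_momentDensityDx hb.ne' ψ) x
  rw [integral_wignerDx hb] at hwignerDx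
  rw [integral_momentDensityDx hb] at hmomentDx
  exact ((hmomentDx.mul hwigner).sub
    ((tendsto_gaussMarginal_momentDensity hb ψ x).mul hwignerDx)).div (hwigner.pow 2)
      (pow_ne_zero 2 (density_pos h).ne')

lemma tendsto_gaussAvg_gaussPrimitive_wigner (hb : 0 < hbar) (ψ : 𝓢(ℝ, ℂ)) (p x : ℝ) :
    Tendsto (fun σ : ℝ × ℝ => gaussAvg σ.2 (fun q => gaussPrimitive σ.1 (p - q))
      (wigner hbar ψ) x) bohmianLimit (𝓝 (p * density ψ x - current hbar ψ x)) := by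
  rw [← integral_wigner_eq_density hb, ← integral_momentDensity hb]
  exact tendsto_gaussAvg_gaussPrimitive (rapidDecay_wigner hb.ne' ψ) p x

lemma tendsto_gaussAvg_gaussPrimitive_wignerDx (hb : 0 < hbar) (ψ : 𝓢(ℝ, ℂ)) (p x : ℝ) :
    Tendsto (fun σ : ℝ × ℝ => gaussAvg σ.2 (fun q => gaussPrimitive σ.1 (p - q))
      (wignerDx hbar ψ) x) bohmianLimit (𝓝 (p * densityD1 ψ x - currentD1 hbar ψ x)) := by
  rw [← integral_wignerDx hb, ← integral_momentDensityDx hb]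
  exact tendsto_gaussAvg_gaussPrimitive (rapidDecay_wignerDx hb.ne' ψ) p x

lemma tendsto_gaussAvg_gaussPrimitive_momentDensityDx (hb : 0 < hbar) (ψ : 𝓢(ℝ, ℂ)) (p x : ℝ) :
    Tendsto (fun σ : ℝ × ℝ => gaussAvg σ.2 (fun q => gaussPrimitive σ.1 (p - q))
      (momentDensityDx hbar ψ) x) bohmianLimit
        (𝓝 (p * currentD1 hbar ψ x - secondMomentD1 hbar ψ x)) := by
  rw [← integral_momentDensityDx hb, ← integral_momentum_mul_momentDensityDx hb]
  exact tendsto_gaussAvg_gaussPrimitive (rapidDecay_momentDensityDx hb.ne' ψ) p x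

lemma tendsto_scaled_husimiFlowP (hb : 0 < hbar) (hV : ContDiff ℝ 1 V)
    (hVg : PolyGrowth (deriv V)) (ψ : 𝓢(ℝ, ℂ)) (p x : ℝ) :
    Tendsto (fun σ : ℝ × ℝ => √(2 * π) * σ.1 * husimiFlowP hbar m σ.1 σ.2 V ψ p x)
      bohmianLimit (𝓝 (-(density ψ x * deriv V x))) := by
  have hwidth (c : ℝ) : Tendsto (fun σ : ℝ × ℝ => c / σ.1) bohmianLimit (𝓝 0) :=
    tendsto_fst_bohmianLimit.const_div_atTop c
  have hdiag : (crossDensity ψ ψ x 0 * (forceMean V x 0 : ℂ)).re = density ψ x * deriv V x := by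
    rw [forceMean_zero, Complex.re_mul_ofReal, crossDensity, zero_div, sub_zero, add_zero,
      Complex.conj_mul', ← Complex.ofReal_pow, Complex.ofReal_re, norm_sq_eq_density]
  have hlim := ((Complex.continuous_re.tendsto _).comp
    (tendsto_gaussSampling (quadDecay_crossDensity_mul_forceMean hV hVg ψ ψ)
      tendsto_snd_bohmianLimit (hwidth hbar) (hwidth p) x)).neg
  rw [hdiag] at hlim
  refine hlim.congr' ?_
  filter_upwards [eventually_bohmianLimit_pos] with σ ⟨hp, hx⟩
  rw [husimiFlowP_eq hb hp hx hV hVg, mul_neg, mul_inv_cancel_left₀ (by positivity)]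
  rfl

/-- The constant `1/2` in the Gaussian cdf contributes the derivative of
`r ∫ Q dp - ∫ K(p P) dp`, with `r` the regularized Bohmian momentum, which vanishes identically. -/
lemma scaled_bohmianFlowP_eq (hb : 0 < hbar) {σp σx : ℝ} (hp : 0 < σp) (hx : 0 < σx)
    (h : ψ x ≠ 0) (p : ℝ) : √(2 * π) * σp * bohmianFlowP hbar m σp σx V ψ p x =
      √(2 * π) * σp * husimiFlowP hbar m σp σx V ψ p x - 1 / m *
        (regBohmianMomentumDx hbar σx ψ x *
            gaussAvg σx (fun q => gaussPrimitive σp (p - q)) (wigner hbar ψ) x +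
          regBohmianMomentum hbar σp σx ψ x *
            gaussAvg σx (fun q => gaussPrimitive σp (p - q)) (wignerDx hbar ψ) x -
          gaussAvg σx (fun q => gaussPrimitive σp (p - q)) (momentDensityDx hbar ψ) x) := by
  have hN := (gaussMarginal_wigner_pos hb hx.ne' h x).ne'
  have hcancel : regBohmianMomentumDx hbar σx ψ x * gaussMarginal σx (wigner hbar ψ) x +
      regBohmianMomentum hbar σp σx ψ x * gaussMarginal σx (wignerDx hbar ψ) x =
        gaussMarginal σx (momentDensityDx hbar ψ) x := by
    simp only [regBohmianMomentum_eq hb.ne' hp hx, regBohmianMomentumDx]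
    field_simp
    ring
  have hscale : √(2 * π) * σp * (√(2 * π) * σp)⁻¹ = 1 := mul_inv_cancel₀ (by positivity)
  rw [bohmianFlowP_eq hb.ne' hp hx ψ (hasDerivAt_regBohmianMomentum hb.ne' hp hx ψ hN),
    gaussAvg_gaussCdf hp (rapidDecay_wigner hb.ne' ψ),
    gaussAvg_gaussCdf hp (rapidDecay_wignerDx hb.ne' ψ),
    gaussAvg_gaussCdf hp (rapidDecay_momentDensityDx hb.ne' ψ), ← hcancel]
  linear_combination (-(1 / m) * (regBohmianMomentumDx hbar σx ψ x *
      gaussAvg σx (fun q => gaussPrimitive σp (p - q)) (wigner hbar ψ) x +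
    regBohmianMomentum hbar σp σx ψ x *
      gaussAvg σx (fun q => gaussPrimitive σp (p - q)) (wignerDx hbar ψ) x -
    gaussAvg σx (fun q => gaussPrimitive σp (p - q)) (momentDensityDx hbar ψ) x)) * hscale

lemma tendsto_scaled_bohmianFlowP (hb : 0 < hbar) (hm : m ≠ 0) (hV : ContDiff ℝ 1 V)
    (hVg : PolyGrowth (deriv V)) (h : ψ x ≠ 0) (p : ℝ) :
    Tendsto (fun σ : ℝ × ℝ => √(2 * π) * σ.1 * bohmianFlowP hbar m σ.1 σ.2 V ψ p x)
      bohmianLimit (𝓝 (-(deriv V x + quantumPotentialD1 hbar m ψ x) * density ψ x)) := by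
  have hlim := (tendsto_scaled_husimiFlowP (m := m) hb hV hVg ψ p x).sub
    (((((tendsto_regBohmianMomentumDx hb h).mul
      (tendsto_gaussAvg_gaussPrimitive_wigner hb ψ p x)).add
      ((tendsto_regBohmianMomentum hb h).mul
        (tendsto_gaussAvg_gaussPrimitive_wignerDx hb ψ p x))).sub
      (tendsto_gaussAvg_gaussPrimitive_momentDensityDx hb ψ p x)).const_mul (1 / m))
  have hcancel : bohmianMomentumD1 hbar ψ x * density ψ x +
      bohmianMomentum hbar ψ x * densityD1 ψ x = currentD1 hbar ψ x := by
    have hn := (density_pos h).ne'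
    rw [bohmianMomentum_eq, bohmianMomentumD1]
    field_simp
    ring
  convert hlim.congr' ?_ using 2
  · have hforce := secondMomentD1_sub_eq_quantumPotentialD1 (hbar := hbar) hm h
    field_simp
    linear_combination hforce + p * hcancel
  · filter_upwards [eventually_bohmianLimit_pos] with σ ⟨hp, hx⟩
    exact (scaled_bohmianFlowP_eq hb hp hx h p).symm

lemma tendsto_bohmianFlowX_div_husimi (hb : 0 < hbar) (hm : m ≠ 0) (h : ψ x ≠ 0) (p : ℝ) :
    Tendsto (fun σ : ℝ × ℝ => bohmianFlowX hbar m σ.1 σ.2 V ψ p x / husimi hbar σ.1 σ.2 ψ p x)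
      bohmianLimit (𝓝 (bohmianMomentum hbar ψ x / m)) := by
  refine ((tendsto_regBohmianMomentum hb h).div_const m).congr' ?_
  filter_upwards [eventually_bohmianLimit_pos,
    (tendsto_scaled_husimi hb ψ p x).eventually_ne (density_pos h).ne'] with σ ⟨hp, hx⟩ hQ
  rw [bohmianFlowX_eq hb hm hp hx, ← mul_assoc,
    mul_div_cancel_right₀ _ (right_ne_zero_of_mul hQ), one_div, mul_comm, div_eq_mul_inv]

lemma tendsto_bohmianFlowP_div_husimi (hb : 0 < hbar) (hm : m ≠ 0) (hV : ContDiff ℝ 1 V)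
    (hVg : PolyGrowth (deriv V)) (h : ψ x ≠ 0) (p : ℝ) :
    Tendsto (fun σ : ℝ × ℝ => bohmianFlowP hbar m σ.1 σ.2 V ψ p x / husimi hbar σ.1 σ.2 ψ p x)
      bohmianLimit (𝓝 (-deriv (fun z => V z + quantumPotential hbar m ψ z) x)) := by
  have hn := (density_pos h).ne'
  have hderiv : HasDerivAt (fun z => V z + quantumPotential hbar m ψ z)
      (deriv V x + quantumPotentialD1 hbar m ψ x) x :=
    (hV.differentiable one_ne_zero x).hasDerivAt.add (hasDerivAt_quantumPotential h)
  have hlim := (tendsto_scaled_bohmianFlowP hb hm hV hVg h p).div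
    (tendsto_scaled_husimi hb ψ p x) hn
  rw [mul_div_cancel_right₀ _ hn, ← hderiv.deriv] at hlim
  refine hlim.congr' ?_
  filter_upwards [eventually_bohmianLimit_pos] with σ ⟨hp, _⟩
  exact mul_div_mul_left _ _ (by positivity)

end SingularLimit

end HusimiFluid

end

theorem theorem3 (hbar m : ℝ) (hhbar : 0 < hbar) (hm : 0 < m)
    (V : ℝ → ℝ) (hV : ContDiff ℝ 1 V)
    (hVgrowth : ∃ (C : ℝ) (k : ℕ), ∀ x : ℝ, |deriv V x| ≤ C * (1 + |x|) ^ k) :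
    -- the gauge flow represents the evolution of the fluid, for all positive widths
    (∀ (I : Set ℝ) (ψ : ℝ → SchwartzMap ℝ ℂ), IsOpen I → ContinuousOn ψ I →
      (∀ t ∈ I, ∀ x : ℝ, HasDerivAt (fun s : ℝ => ψ s x)
        (hamiltonian hbar m V (ψ t) x / (Complex.I * (hbar : ℂ))) t) →
      ∀ σp σx : ℝ, 0 < σp → 0 < σx → ∀ t ∈ I, ∀ p x : ℝ,
        DifferentiableAt ℝ (fun s : ℝ => husimi hbar σp σx (ψ s) p x) t ∧
        DifferentiableAt ℝ (fun p' : ℝ => bohmianFlowP hbar m σp σx V (ψ t) p' x) p ∧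
        DifferentiableAt ℝ (fun x' : ℝ => bohmianFlowX hbar m σp σx V (ψ t) p x') x ∧
        deriv (fun s : ℝ => husimi hbar σp σx (ψ s) p x) t =
          -deriv (fun p' : ℝ => bohmianFlowP hbar m σp σx V (ψ t) p' x) p
          - deriv (fun x' : ℝ => bohmianFlowX hbar m σp σx V (ψ t) p x') x) ∧
    -- the flow in the singular limit
    (∀ (ψ : SchwartzMap ℝ ℂ) (p x : ℝ), ψ x ≠ 0 →
      Tendsto (fun σ : ℝ × ℝ => Real.sqrt (2 * Real.pi) * σ.1 * husimi hbar σ.1 σ.2 ψ p x)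
        bohmianLimit (𝓝 (‖ψ x‖ ^ 2)) ∧
      Tendsto (fun σ : ℝ × ℝ => regBohmianMomentum hbar σ.1 σ.2 ψ x)
        bohmianLimit (𝓝 (bohmianMomentum hbar ψ x)) ∧
      Tendsto (fun σ : ℝ × ℝ =>
          bohmianFlowX hbar m σ.1 σ.2 V ψ p x / husimi hbar σ.1 σ.2 ψ p x)
        bohmianLimit (𝓝 (bohmianMomentum hbar ψ x / m)) ∧
      Tendsto (fun σ : ℝ × ℝ =>
          bohmianFlowP hbar m σ.1 σ.2 V ψ p x / husimi hbar σ.1 σ.2 ψ p x)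
        bohmianLimit (𝓝 (-deriv (fun z : ℝ => V z + quantumPotential hbar m ψ z) x))) := by
  refine ⟨fun I ψ hI hψ hd σp σx hp hx t ht p x =>
    continuity_equation hhbar hm.ne' hV hVgrowth hI hψ hd hp hx ht p x, fun ψ p x h => ⟨?_,
      tendsto_regBohmianMomentum hhbar h, tendsto_bohmianFlowX_div_husimi hhbar hm.ne' h p,
      tendsto_bohmianFlowP_div_husimi hhbar hm.ne' hV hVgrowth h p⟩⟩
  rw [norm_sq_eq_density]
  exact tendsto_scaled_husimi hhbar ψ p x
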